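/- Let $\mathrm R$ be a finite (not necessarily crystallographic) root system with a basis $B$ and positive roots $\mathrm R^+$, let $F\subseteq\mathbb R$ be a subfield containing all $\langle\alpha,\beta^\vee\rangle$ ($\alpha,\beta\in\mathrm R$), and let $\Lambda$ be a totally ordered abelian group that is an ordered $F$-module (products of nonnegative elements of $F$ and of $\Lambda$ are nonnegative). Put $\mathbb A=\mathrm{span}_F(\mathrm R)\otimes_F\Lambda$, with the linear action of the spherical Weyl group $\overline W$, the $\Lambda$-valued evaluations $x\mapsto\langle x,\alpha^\vee\rangle$, and the distance $d(x,y)=\sum_{\alpha\in\mathrm R^+}|\langle y-x,\alpha^\vee\rangle|$. Let $T\neq 0$ be a subgroup of $\mathbb A$ normalized by $\overline W$, and $\overline WT=\overline W\ltimes T$ the group of maps $x\mapsto wx+t$. A *half-apartment* of $\mathbb A$ is a set $\{x:\langle x,\alpha^\vee\rangle\ge\lambda\}$ with $\alpha\in\mathrm R$, $\lambda\in\Lambda$; a subset of $\mathbb A$ is *convex* if it is a finite intersection of half-apartments; a *Weyl chamber* of $\mathbb A$ is an image of $\{x:\langle x,\alpha^\vee\rangle\ge0\ \forall\alpha\in\mathrm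 R^+\}$ under $\overline W\ltimes\mathbb A$. A *generalized affine building* modelled on these data is a set $X$ with a collection $\mathcal A$ of injective maps $f:\mathbb A\to X$ (charts; their images are the *apartments*, and Weyl chambers and half-apartments of $X$ are the images of those of $\mathbb A$ under charts) such that 1. $f\circ w\in\mathcal A$ for all $f\in\mathcal A$, $w\in\overline WT$; 2. if $f,g\in\mathcal A$ and $f(\mathbb A)\cap g(\mathbb A)\ne\emptyset$, then $f^{-1}(g(\mathbb A))$ is convex, and there is $w\in\overline WT$ such that $f$ and $g\circ w$ agree on $f^{-1}(g(\mathbb A))$; 3. any two points of $X$ lie in a common apartment (so that the distance of $\mathbb A$ induces a well-defined function $d:X\times X\to\Lambda$, computed in any chart of an apartment containing both points); 4. any two Weyl chambers $S_1,S_2$ of $X$ contain Weyl chambers $S_1'\subseteq S_1$, $S_2'\subseteq S_2$ of $X$ that lie in a common apartment; 5. for every apartment $A$ and $x\in A$ there is a map $r:X\to A$ that is the identity on $A$, satisfies $d(r(y),r(z))\le d(y,z)$ for all $y,z\in X$, and has $r^{-1}(x)=\{x\}$; 6. if three apartments pairwise intersect in half-apartments, then the intersection of all three is nonempty. Let $(X,\mathcal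 A)$ be a generalized affine building and $x,y\in X$. Then the segment $\mathrm{seg}(x,y)=\{z\in X: d(x,y)=d(x,z)+d(z,y)\}$ is contained in a single apartment: there is $f\in\mathcal A$ with $\mathrm{seg}(x,y)\subseteq f(\mathbb A)$. -/

import Mathlib

open scoped TensorProduct

namespace GenAffineBuilding

noncomputable section

variable {F : Subfield ℝ} {ι M N : Type*} [AddCommGroup M] [Module F M]
  [AddCommGroup N] [Module F N]

/-! ### The model space -/

/-- A basis of a root system (not necessarily crystallographic): a linearly independent set of
roots such that every root is a combination of basis elements whose coefficients are either all
nonnegative or all nonpositive. -/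
structure IsRootBasis (P : RootPairing ι F M N) (B : Set ι) : Prop where
  linearIndepOn : LinearIndepOn F P.root B
  pos_or_neg (i : ι) : P.root i ∈ PointedCone.hull F (P.root '' B) ∨
    -P.root i ∈ PointedCone.hull F (P.root '' B)

/-- The root with index `i` is positive with respect to the basis `B`. -/
def IsPositive (P : RootPairing ι F M N) (B : Set ι) (i : ι) : Prop :=
  P.root i ∈ PointedCone.hull F (P.root '' B)

variable (Λ : Type*) [AddCommGroup Λ] [Module F Λ]

/-- The model space `span_F(R) ⊗_F Λ`; the roots of `P` span `M` when `P` is a root system. -/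
abbrev ModelSpace (_P : RootPairing ι F M N) : Type _ := M ⊗[F] Λ

variable {Λ}

/-- The evaluation `x ↦ ⟨x, α_i^∨⟩`, the linear extension of `m ⊗ μ ↦ ⟨m, α_i^∨⟩ μ`. -/
def coeval (P : RootPairing ι F M N) (i : ι) : ModelSpace Λ P →ₗ[F] Λ :=
  (TensorProduct.lid F Λ).toLinearMap ∘ₗ LinearMap.rTensor Λ (P.coroot' i)

/-- The linear reflection `r_α` of the model space, `m ⊗ μ ↦ s_α(m) ⊗ μ`. -/
def modelReflection (P : RootPairing ι F M N) (i : ι) : ModelSpace Λ P ≃ₗ[F] ModelSpace Λ P :=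
  LinearEquiv.rTensor Λ (P.reflection i)

variable (Λ) in
/-- The spherical Weyl group acting on the model space. -/
def sphericalWeylGroup (P : RootPairing ι F M N) :
    Subgroup (ModelSpace Λ P ≃ₗ[F] ModelSpace Λ P) :=
  Subgroup.closure (Set.range (modelReflection P))

/-- A translation group of the model space, identified with the set of translation vectors:
nontrivial and normalized by the spherical Weyl group. -/
structure IsTranslationGroup (P : RootPairing ι F M N) (T : AddSubgroup (ModelSpace Λ P)) :
    Prop where
  ne_bot : T ≠ ⊥
  weyl_mem : ∀ w ∈ sphericalWeylGroup Λ P, ∀ t ∈ T, w t ∈ T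

/-- The affine Weyl group with translation part `T`, as a set of self-maps of the model space:
the maps `x ↦ w x + t` with `w` in the spherical Weyl group and `t ∈ T`. For `T = ⊤` this is the
full affine Weyl group. -/
def affineWeylGroup (P : RootPairing ι F M N) (T : AddSubgroup (ModelSpace Λ P)) :
    Set (ModelSpace Λ P → ModelSpace Λ P) :=
  {g | ∃ w ∈ sphericalWeylGroup Λ P, ∃ t ∈ T, ∀ x, g x = w x + t}

variable [LinearOrder Λ]

/-- The half-apartment `{x | μ ≤ ⟨x, α_i^∨⟩}`. The opposite half-apartments
`{x | ⟨x, α_i^∨⟩ ≤ μ}` are of this form too, for the root `-α_i` and the constant `-μ`. -/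
def halfApartment (P : RootPairing ι F M N) (i : ι) (μ : Λ) : Set (ModelSpace Λ P) :=
  {x | μ ≤ coeval P i x}

/-- Convex subsets of the model space: finite intersections of half-apartments. -/
def IsConvex (P : RootPairing ι F M N) (Y : Set (ModelSpace Λ P)) : Prop :=
  ∃ s : Finset (ι × Λ), Y = ⋂ a ∈ s, halfApartment P a.1 a.2

variable (Λ) in
/-- The fundamental Weyl chamber with respect to the basis `B`. -/
def fundamentalChamber (P : RootPairing ι F M N) (B : Set ι) : Set (ModelSpace Λ P) :=
  {x | ∀ i, IsPositive P B i → 0 ≤ coeval P i x}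

/-- Weyl chambers of the model space: images of the fundamental Weyl chamber under the full
affine Weyl group. -/
def IsWeylChamber (P : RootPairing ι F M N) (B : Set ι) (S : Set (ModelSpace Λ P)) : Prop :=
  ∃ g ∈ affineWeylGroup P (⊤ : AddSubgroup (ModelSpace Λ P)), S = g '' fundamentalChamber Λ P B

open Classical in
/-- The distance `d(x, y) = ∑_{α ∈ R⁺} |⟨y - x, α^∨⟩|` of the model space. -/
def modelDist [Fintype ι] (P : RootPairing ι F M N) (B : Set ι) (x y : ModelSpace Λ P) : Λ :=
  ∑ i with IsPositive P B i, |coeval P i (y - x)|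

/-! ### Generalized affine buildings -/

variable {X : Type*}

open Classical in
/-- The distance on `X` induced by an atlas: the distance of the preimages of `x` and `y` under a
chart of an apartment containing both (with value `0` if there is no such chart). -/
def atlasDist [Fintype ι] (P : RootPairing ι F M N) (B : Set ι) (𝒜 : Set (ModelSpace Λ P → X))
    (x y : X) : Λ :=
  if h : ∃ a : (ModelSpace Λ P → X) × ModelSpace Λ P × ModelSpace Λ P,
      a.1 ∈ 𝒜 ∧ a.1 a.2.1 = x ∧ a.1 a.2.2 = y then
    modelDist P B h.choose.2.1 h.choose.2.2
  else 0

/-- Weyl chambers of `X`: images of Weyl chambers of the model space under charts. -/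
def IsChamberOf (P : RootPairing ι F M N) (B : Set ι) (𝒜 : Set (ModelSpace Λ P → X))
    (S : Set X) : Prop :=
  ∃ f ∈ 𝒜, ∃ C, IsWeylChamber P B C ∧ S = f '' C

/-- Half-apartments of `X`: images of half-apartments of the model space under charts. -/
def IsHalfApartmentOf (P : RootPairing ι F M N) (𝒜 : Set (ModelSpace Λ P → X))
    (H : Set X) : Prop :=
  ∃ f ∈ 𝒜, ∃ i μ, H = f '' halfApartment P i μ

/-- `X` is a generalized affine building with atlas `𝒜`, modelled on `span_F(R) ⊗_F Λ` with the
affine Weyl group whose translation part is `T`. The apartments are the ranges of the charts. -/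
structure IsAffineBuilding [Fintype ι] (P : RootPairing ι F M N) (B : Set ι)
    (T : AddSubgroup (ModelSpace Λ P)) (𝒜 : Set (ModelSpace Λ P → X)) : Prop where
  /-- Charts are injective. -/
  injective : ∀ f ∈ 𝒜, Function.Injective f
  /-- The atlas is stable under precomposition with the affine Weyl group. -/
  comp_mem : ∀ f ∈ 𝒜, ∀ w ∈ affineWeylGroup P T, f ∘ w ∈ 𝒜
  /-- Intersections of apartments are convex in charts. -/
  convex_inter : ∀ f ∈ 𝒜, ∀ g ∈ 𝒜, (Set.range f ∩ Set.range g).Nonempty →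
    IsConvex P (f ⁻¹' Set.range g)
  /-- Coordinate changes are given by the affine Weyl group. -/
  compatible : ∀ f ∈ 𝒜, ∀ g ∈ 𝒜, (Set.range f ∩ Set.range g).Nonempty →
    ∃ w ∈ affineWeylGroup P T, Set.EqOn f (g ∘ w) (f ⁻¹' Set.range g)
  /-- Any two points lie in a common apartment. -/
  common_apartment : ∀ x y : X, ∃ f ∈ 𝒜, x ∈ Set.range f ∧ y ∈ Set.range f
  /-- Any two Weyl chambers contain Weyl chambers that lie in a common apartment. -/
  subchambers : ∀ S₁ S₂ : Set X, IsChamberOf P B 𝒜 S₁ → IsChamberOf P B 𝒜 S₂ →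
    ∃ S₁' S₂' : Set X, IsChamberOf P B 𝒜 S₁' ∧ IsChamberOf P B 𝒜 S₂' ∧ S₁' ⊆ S₁ ∧ S₂' ⊆ S₂ ∧
      ∃ f ∈ 𝒜, S₁' ∪ S₂' ⊆ Set.range f
  /-- Every apartment is the image of a distance non-increasing retraction whose fiber over a
  given point `x` of the apartment is `{x}`. -/
  retraction : ∀ f ∈ 𝒜, ∀ x ∈ Set.range f, ∃ r : X → X,
    (∀ z, r z ∈ Set.range f) ∧ (∀ z ∈ Set.range f, r z = z) ∧
    (∀ y z, atlasDist P B 𝒜 (r y) (r z) ≤ atlasDist P B 𝒜 y z) ∧ r ⁻¹' {x} = {x}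
  /-- Three apartments that pairwise intersect in half-apartments have a common point. -/
  inter_nonempty : ∀ f ∈ 𝒜, ∀ g ∈ 𝒜, ∀ h ∈ 𝒜,
    IsHalfApartmentOf P 𝒜 (Set.range f ∩ Set.range g) →
    IsHalfApartmentOf P 𝒜 (Set.range g ∩ Set.range h) →
    IsHalfApartmentOf P 𝒜 (Set.range f ∩ Set.range h) →
    (Set.range f ∩ Set.range g ∩ Set.range h).Nonempty

/-- The segment `seg(x, y) = {z | d(x, y) = d(x, z) + d(z, y)}`. -/
def seg [Fintype ι] (P : RootPairing ι F M N) (B : Set ι) (𝒜 : Set (ModelSpace Λ P → X))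
    (x y : X) : Set X :=
  {z | atlasDist P B 𝒜 x y = atlasDist P B 𝒜 x z + atlasDist P B 𝒜 z y}

end

end GenAffineBuilding

namespace GenAffineBuilding

section WellDefined

variable {F : Subfield ℝ} {ι M N : Type*} [AddCommGroup M] [Module F M]
  [AddCommGroup N] [Module F N] {Λ : Type*} [AddCommGroup Λ] [Module F Λ]

lemma coeval_reflection (P : RootPairing ι F M N) (i j : ι) (x : ModelSpace Λ P) :
    coeval P j (modelReflection P i x) = coeval P (P.reflectionPerm i j) x := by
  induction x using TensorProduct.induction_on with
  | zero => simp
  | add x y hx hy => simp [hx, hy]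
  | tmul m l =>
    simp only [coeval, modelReflection, LinearMap.comp_apply, LinearEquiv.coe_coe,
      LinearEquiv.rTensor_tmul, LinearMap.rTensor_tmul, TensorProduct.lid_tmul,
      P.coroot'_reflection]

lemma coeval_neg_index (P : RootPairing ι F M N) (i : ι) (x : ModelSpace Λ P) :
    coeval P (P.reflectionPerm i i) x = -coeval P i x := by
  induction x using TensorProduct.induction_on with
  | zero => simp
  | add x y hx hy => simp [hx, hy, add_comm]
  | tmul m l => simp [coeval, P.coroot_reflectionPerm]

lemma root_neg_index (P : RootPairing ι F M N) (i : ι) :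
    P.root (P.reflectionPerm i i) = -P.root i := by
  rw [P.root_reflectionPerm, P.reflection_apply_self]

/-- Exactly one of a root and its negative is positive. -/
lemma IsRootBasis.isPositive_neg_iff {P : RootPairing ι F M N} {B : Set ι}
    (hB : IsRootBasis P B) (i : ι) :
    IsPositive P B (P.reflectionPerm i i) ↔ ¬ IsPositive P B i := by
  have hr := root_neg_index P i
  refine ⟨fun h' h => ?_, fun h => ?_⟩
  · unfold IsPositive at h h'
    rw [hr] at h'
    obtain ⟨c, hc, hc0, hcs⟩ := PointedCone.mem_hull_set.1 h
    obtain ⟨c', hc', hc0', hcs'⟩ := PointedCone.mem_hull_set.1 h'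
    have hli : LinearIndepOn F id (P.root '' B) := hB.linearIndepOn.id_image
    have hz : c + c' = 0 := by
      refine linearIndepOn_iff.1 hli (c + c') (Submodule.add_mem _ hc hc') ?_
      rw [map_add, Finsupp.linearCombination_apply, Finsupp.linearCombination_apply]
      simp only [id]
      rw [hcs, hcs', add_neg_cancel]
    have hc00 : c = 0 := by
      ext y
      have h1 := DFunLike.congr_fun hz y
      have h2 := hc0 y
      have h3 := hc0' y
      simp only [Finsupp.add_apply, Finsupp.zero_apply] at h1 ⊢
      exact congrArg _ (le_antisymm (by linarith) h2)
    subst hc00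
    exact P.ne_zero i (by simpa using hcs.symm)
  · unfold IsPositive
    rw [hr]
    exact (hB.pos_or_neg i).resolve_left h

variable [LinearOrder Λ] [Fintype ι]

lemma two_nsmul_modelDist (P : RootPairing ι F M N) {B : Set ι} (hB : IsRootBasis P B)
    (x y : ModelSpace Λ P) : 2 • modelDist P B x y = ∑ i, |coeval P i (y - x)| := by
  classical
  have h : ∑ i with IsPositive P B i, |coeval P i (y - x)| =
      ∑ i with ¬ IsPositive P B i, |coeval P i (y - x)| := by
    refine Finset.sum_nbij' (fun i => P.reflectionPerm i i) (fun i => P.reflectionPerm i i)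
      ?_ ?_ ?_ ?_ ?_
    · intro i hi
      simp only [Finset.mem_filter, Finset.mem_univ, true_and] at hi ⊢
      rw [hB.isPositive_neg_iff]
      exact not_not.2 hi
    · intro i hi
      simp only [Finset.mem_filter, Finset.mem_univ, true_and] at hi ⊢
      rwa [hB.isPositive_neg_iff]
    · intro i _
      exact P.root.injective (by rw [root_neg_index, root_neg_index, neg_neg])
    · intro i _
      exact P.root.injective (by rw [root_neg_index, root_neg_index, neg_neg])
    · intro i _
      rw [coeval_neg_index, abs_neg]
  rw [← Finset.sum_filter_add_sum_filter_not Finset.univ (fun i => IsPositive P B i), ← h, two_nsmul]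
  unfold modelDist
  congr!

variable [IsOrderedAddMonoid Λ]

/-- The distance of the model space is invariant under the affine Weyl group. -/
lemma modelDist_affineWeylGroup (P : RootPairing ι F M N) {B : Set ι} (hB : IsRootBasis P B)
    {T : AddSubgroup (ModelSpace Λ P)} {g : ModelSpace Λ P → ModelSpace Λ P}
    (hg : g ∈ affineWeylGroup P T) (x y : ModelSpace Λ P) :
    modelDist P B (g x) (g y) = modelDist P B x y := by
  obtain ⟨w, hw, t, -, hgw⟩ := hg
  have key : ∀ z : ModelSpace Λ P, ∑ i, |coeval P i (w z)| = ∑ i, |coeval P i z| := by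
    clear hgw
    induction hw using Subgroup.closure_induction with
    | mem w hw =>
      obtain ⟨j, rfl⟩ := hw
      intro z
      simp only [coeval_reflection]
      exact Equiv.sum_comp (P.reflectionPerm j) (fun i => |coeval P i z|)
    | one => intro z; rfl
    | mul a b _ _ ha hb => intro z; rw [LinearEquiv.mul_apply, ha, hb]
    | inv a _ ha =>
      intro z
      rw [← ha]
      congr! 3
      exact a.apply_symm_apply z
  refine nsmul_right_injective (two_ne_zero) ?_
  simp only [two_nsmul_modelDist P hB, hgw]
  rw [← key (y - x), map_sub]
  simp only [add_sub_add_right_eq_sub]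

/-- The distance on a generalized affine building can be computed in any chart. -/
lemma IsAffineBuilding.atlasDist_eq {X : Type*} {P : RootPairing ι F M N} {B : Set ι}
    (hB : IsRootBasis P B) {T : AddSubgroup (ModelSpace Λ P)} {𝒜 : Set (ModelSpace Λ P → X)}
    (hX : IsAffineBuilding P B T 𝒜) {f : ModelSpace Λ P → X} (hf : f ∈ 𝒜)
    (p q : ModelSpace Λ P) : atlasDist P B 𝒜 (f p) (f q) = modelDist P B p q := by
  have h : ∃ a : (ModelSpace Λ P → X) × ModelSpace Λ P × ModelSpace Λ P,
      a.1 ∈ 𝒜 ∧ a.1 a.2.1 = f p ∧ a.1 a.2.2 = f q := ⟨(f, p, q), hf, rfl, rfl⟩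
  rw [atlasDist, dif_pos h]
  obtain ⟨hg, hp, hq⟩ := h.choose_spec
  generalize h.choose = a at hg hp hq
  obtain ⟨g, p', q'⟩ := a
  dsimp only at hg hp hq ⊢
  obtain ⟨w, hw, hfg⟩ := hX.compatible g hg f hf ⟨f p, ⟨p', hp⟩, ⟨p, rfl⟩⟩
  have h1 : w p' = p := hX.injective f hf ((hfg (x := p') ⟨p, hp.symm⟩).symm.trans hp)
  have h2 : w q' = q := hX.injective f hf ((hfg (x := q') ⟨q, hq.symm⟩).symm.trans hq)
  rw [← h1, ← h2, modelDist_affineWeylGroup P hB hw]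

end WellDefined

end GenAffineBuilding

namespace GenAffineBuilding

noncomputable section

section Roots

variable {F : Subfield ℝ} {ι M N : Type*} [AddCommGroup M] [Module F M]
  [AddCommGroup N] [Module F N] {P : RootPairing ι F M N} {B : Set ι}

/-! ### Positive roots and simple roots -/

/-! Choose a chart `f` with `x = f p`, `y = f q` and `q - p` in the closed fundamental chamber `C`.
Its range already contains the whole segment. Let `S` be `coevalSum`, the sum of the positive
coroots. If `v - u` lies in `C`, then `d(u, v) = S(v) - S(u)`. Given `z` in the segment, let `a₀` be
its coordinate in a chart agreeing with `f` far out in `C`, and `a` its coordinate in a chart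
agreeing with `f` far out in `-C`. Comparing with far points in both directions, the triangle
inequality gives `S(q) - S(a₀) ≤ d(z, y)` and `S(a) - S(p) ≤ d(x, z)`, hence `S(a) ≤ S(a₀)`.

On the other hand, one can walk from `C` to `-C` through adjacent chambers at infinity of `f`,
changing the chart at each step so that it keeps `z` and contains the next chamber
(`exists_gallery`). A step either fixes the coordinate of `z` or moves it by a positive multiple of
a positive root, which raises `S`. So for `z` in the segment nothing moves, and one apartment
contains `z` together with cones of `f` in the directions `C` and `-C`. A convex set containing
opposite cones is everything (`eq_univ_of_opposite`), so `z` lies in the apartment of `f`.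

A single step is `exists_step`. If the next chamber is not at infinity of the current apartment,
`exists_half` joins it to each of two half-apartments bounded by walls in the direction of the
common panel. The three resulting apartments pairwise meet in half-apartments, so they have a common
point. The coordinate of `z` is then unchanged or is reflected in the wall through that point.

The spherical building at infinity is handled through charts: `RelPos` is the Weyl distance, and
`Adj` means that panel rays stay at bounded distance. The link is `RelPos.adj`: adjacent chambers
have positions `v` or `v s_b`. It rests on `apply_eq_of_rootNorm_eq`. The gluing rests on
`RelPos.gate`. -/

lemma IsRootBasis.isPositive_of_mem {i : ι} (hi : i ∈ B) : IsPositive P B i :=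
  PointedCone.subset_hull (Set.mem_image_of_mem _ hi)

lemma IsRootBasis.top_le_span (hB : IsRootBasis P B) [P.IsRootSystem] :
    ⊤ ≤ Submodule.span F (Set.range fun b : B => P.root b) := by
  have h : Set.range (fun b : B => P.root b) = P.root '' B := by
    ext; simp
  rw [← RootPairing.IsRootSystem.span_root_eq_top (P := P), h, Submodule.span_le]
  rintro _ ⟨i, rfl⟩
  rcases hB.pos_or_neg i with hi | hi
  · exact PointedCone.hull_le_span F _ hi
  · exact neg_mem_iff.1 (PointedCone.hull_le_span F _ hi)

/-- The basis of the ambient space formed by the simple roots. -/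
def IsRootBasis.basis (hB : IsRootBasis P B) [P.IsRootSystem] : Module.Basis B F M :=
  Module.Basis.mk hB.linearIndepOn hB.top_le_span

lemma IsRootBasis.basis_apply (hB : IsRootBasis P B) [P.IsRootSystem] (b : B) :
    hB.basis b = P.root b :=
  Module.Basis.mk_apply hB.linearIndepOn hB.top_le_span b

lemma IsRootBasis.repr_nonneg (hB : IsRootBasis P B) [P.IsRootSystem] {i : ι}
    (hi : IsPositive P B i) (b : B) : 0 ≤ hB.basis.repr (P.root i) b := by
  classical
  obtain ⟨c, hc, hc0, hcs⟩ := PointedCone.mem_hull_set.1 hi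
  rw [← hcs, Finsupp.sum, map_sum, Finsupp.finsetSum_apply]
  refine Finset.sum_nonneg fun m hm => ?_
  obtain ⟨a, ha, rfl⟩ := hc hm
  rw [map_smul, show P.root a = hB.basis ⟨a, ha⟩ from (hB.basis_apply ⟨a, ha⟩).symm,
    Module.Basis.repr_self]
  refine mul_nonneg (hc0 _) ?_
  rw [Finsupp.single_apply]
  split_ifs <;> simp

lemma IsRootBasis.isPositive_of_repr_pos (hB : IsRootBasis P B) [P.IsRootSystem] {i : ι} {b : B}
    (hi : 0 < hB.basis.repr (P.root i) b) : IsPositive P B i := by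
  by_contra h
  have := hB.repr_nonneg ((hB.isPositive_neg_iff i).2 h) b
  rw [root_neg_index, map_neg, Finsupp.neg_apply] at this
  linarith

lemma IsRootBasis.exists_repr_pos (hB : IsRootBasis P B) [P.IsRootSystem] {i : ι}
    (hi : IsPositive P B i) : ∃ b, 0 < hB.basis.repr (P.root i) b := by
  by_contra! h
  refine P.ne_zero i (hB.basis.repr.injective ?_)
  ext b
  rw [map_zero]
  exact congrArg _ (le_antisymm (h b) (hB.repr_nonneg hi b))

lemma IsRootBasis.isPositive_iff (hB : IsRootBasis P B) [P.IsRootSystem] {i : ι} :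
    IsPositive P B i ↔ ∀ b, 0 ≤ hB.basis.repr (P.root i) b := by
  refine ⟨hB.repr_nonneg, fun h => by_contra fun h' => ?_⟩
  obtain ⟨b, hb⟩ := hB.exists_repr_pos ((hB.isPositive_neg_iff i).2 h')
  rw [root_neg_index, map_neg, Finsupp.neg_apply] at hb
  linarith [h b]

variable [Fintype ι]

omit [Fintype ι] in
lemma IsRootBasis.root_eq_sum [Fintype B] (hB : IsRootBasis P B) [P.IsRootSystem] (i : ι) :
    P.root i = ∑ b : B, hB.basis.repr (P.root i) b • P.root b := by
  conv_lhs => rw [← hB.basis.sum_repr (P.root i)]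
  simp only [hB.basis_apply]

lemma rootForm_root_pos [P.IsRootSystem] (i : ι) : 0 < P.RootForm (P.root i) (P.root i) :=
  P.rootForm_pos_of_ne_zero (Submodule.subset_span ⟨i, rfl⟩) (P.ne_zero i)

/-- The coefficients of a coroot with respect to the simple coroots. -/
def IsRootBasis.corootCoeff (hB : IsRootBasis P B) [P.IsRootSystem] (i : ι) (b : B) : F :=
  hB.basis.repr (P.root i) b * P.RootForm (P.root b) (P.root b) / P.RootForm (P.root i) (P.root i)

/-- A coroot times the squared length of its root (for `P.RootForm`) depends linearly on the root.
So the expansion in simple roots carries over to coroots with positive rescalings, and signs are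
preserved. -/
lemma IsRootBasis.coroot_eq_sum [Fintype B] (hB : IsRootBasis P B) [P.IsRootSystem] (i : ι) :
    P.coroot i = ∑ b : B, hB.corootCoeff i b • P.coroot b := by
  have hi := rootForm_root_pos (P := P) i
  refine smul_right_injective _ hi.ne' ?_
  simp only
  rw [P.rootForm_self_smul_coroot, hB.root_eq_sum i, map_sum, Finset.smul_sum, Finset.smul_sum]
  refine Finset.sum_congr rfl fun b _ => ?_
  rw [← hB.root_eq_sum i, map_smul, smul_comm, ← P.rootForm_self_smul_coroot, smul_smul, smul_smul,
    corootCoeff]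
  congr 1
  field_simp

lemma IsRootBasis.coroot'_eq_sum [Fintype B] (hB : IsRootBasis P B) [P.IsRootSystem] (i : ι) :
    P.coroot' i = ∑ b : B, hB.corootCoeff i b • P.coroot' b := by
  rw [RootPairing.coroot', hB.coroot_eq_sum i, map_sum]
  simp only [map_smul]

lemma IsRootBasis.corootCoeff_nonneg (hB : IsRootBasis P B) [P.IsRootSystem] {i : ι}
    (hi : IsPositive P B i) (b : B) : 0 ≤ hB.corootCoeff i b :=
  div_nonneg (mul_nonneg (hB.repr_nonneg hi b) (rootForm_root_pos _).le) (rootForm_root_pos _).le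

lemma IsRootBasis.exists_corootCoeff_pos (hB : IsRootBasis P B) [P.IsRootSystem] {i : ι}
    (hi : IsPositive P B i) : ∃ b, 0 < hB.corootCoeff i b := by
  obtain ⟨b, hb⟩ := hB.exists_repr_pos hi
  exact ⟨b, div_pos (mul_pos hb (rootForm_root_pos _)) (rootForm_root_pos _)⟩

lemma IsRootBasis.coroot'_nonneg (hB : IsRootBasis P B) [P.IsRootSystem] {x : M}
    (hx : ∀ b ∈ B, 0 ≤ P.coroot' b x) {i : ι} (hi : IsPositive P B i) : 0 ≤ P.coroot' i x := by
  classical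
  rw [hB.coroot'_eq_sum, LinearMap.sum_apply]
  exact Finset.sum_nonneg fun b _ => mul_nonneg (hB.corootCoeff_nonneg hi b) (hx b b.2)

lemma IsRootBasis.coroot'_pos (hB : IsRootBasis P B) [P.IsRootSystem] {x : M}
    (hx : ∀ b ∈ B, 0 < P.coroot' b x) {i : ι} (hi : IsPositive P B i) : 0 < P.coroot' i x := by
  classical
  rw [hB.coroot'_eq_sum, LinearMap.sum_apply]
  obtain ⟨b, hb⟩ := hB.exists_corootCoeff_pos hi
  exact Finset.sum_pos' (fun b _ => mul_nonneg (hB.corootCoeff_nonneg hi b) (hx b b.2).le)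
    ⟨b, Finset.mem_univ _, mul_pos hb (hx b b.2)⟩

/-- Vectors with prescribed values of the simple coroots. -/
lemma IsRootBasis.exists_coroot'_eq (hB : IsRootBasis P B) [P.IsRootSystem] (c : B → F) :
    ∃ x : M, ∀ b : B, P.coroot' b x = c b := by
  have hli : LinearIndepOn F P.coroot B := P.linearIndepOn_coroot_iff.2 hB.linearIndepOn
  have hsp : ⊤ ≤ Submodule.span F (Set.range fun b : B => P.coroot b) := by
    classical
    rw [← RootPairing.IsRootSystem.span_coroot_eq_top (P := P), Submodule.span_le]
    rintro _ ⟨i, rfl⟩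
    rw [hB.coroot_eq_sum i]
    exact Submodule.sum_mem _ fun b _ => Submodule.smul_mem _ _ (Submodule.subset_span ⟨b, rfl⟩)
  let e : Module.Basis B F N := Module.Basis.mk hli hsp
  obtain ⟨x, hx⟩ := (LinearMap.IsPerfPair.bijective_left P.toLinearMap).2 (e.constr F c)
  refine ⟨x, fun b => ?_⟩
  have h := e.constr_basis F c b
  rw [← hx, show e b = P.coroot b from Module.Basis.mk_apply hli hsp b] at h
  exact h

/-- A vector with positive values of all positive coroots. -/
lemma IsRootBasis.exists_regular (hB : IsRootBasis P B) [P.IsRootSystem] :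
    ∃ x : M, ∀ i, IsPositive P B i → 0 < P.coroot' i x := by
  obtain ⟨x, hx⟩ := hB.exists_coroot'_eq (fun _ => 1)
  exact ⟨x, fun i hi => hB.coroot'_pos (fun b hb => by rw [hx ⟨b, hb⟩]; exact one_pos) hi⟩

/-- The root `j` is a multiple of the root `i`. -/
def IsParallel (P : RootPairing ι F M N) (i j : ι) : Prop := ∃ c : F, P.root j = c • P.root i

omit [Fintype ι] in
lemma isParallel_self (i : ι) : IsParallel P i i := ⟨1, (one_smul _ _).symm⟩

omit [Fintype ι] in
-- The coefficient found here is left alone by the reflection in `b`, so it decides the sign of the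
-- reflected root.
lemma IsRootBasis.exists_repr_pos_ne (hB : IsRootBasis P B) [P.IsRootSystem] {j : ι}
    (hj : IsPositive P B j) {b : B} (h : ¬ IsParallel P b j) :
    ∃ b' ≠ b, 0 < hB.basis.repr (P.root j) b' := by
  by_contra! h'
  refine h ⟨hB.basis.repr (P.root j) b, hB.basis.repr.injective ?_⟩
  ext b'
  rw [map_smul, ← hB.basis_apply, Module.Basis.repr_self, Finsupp.smul_apply]
  by_cases hbb : b' = b
  · subst hbb; simp
  · rw [Finsupp.single_eq_of_ne hbb, smul_zero]
    exact congrArg _ (le_antisymm (h' b' hbb) (hB.repr_nonneg hj b'))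

omit [Fintype ι] in
/-- A simple reflection permutes the positive roots that are not multiples of the simple root. -/
lemma IsRootBasis.isPositive_reflectionPerm (hB : IsRootBasis P B) [P.IsRootSystem] {j : ι}
    (hj : IsPositive P B j) {b : B} (h : ¬ IsParallel P b j) :
    IsPositive P B (P.reflectionPerm b j) := by
  obtain ⟨b', hbb, hpos⟩ := hB.exists_repr_pos_ne hj h
  refine hB.isPositive_of_repr_pos (b := b') ?_
  rw [P.root_reflectionPerm, P.reflection_apply, map_sub, map_smul, Finsupp.sub_apply,
    Finsupp.smul_apply, ← hB.basis_apply, Module.Basis.repr_self, Finsupp.single_eq_of_ne hbb,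
    smul_zero, sub_zero]
  exact hpos

omit [Fintype ι] in
lemma IsParallel.reflectionPerm {i j : ι} : IsParallel P i (P.reflectionPerm i j) ↔
    IsParallel P i j := by
  have key : ∀ j, IsParallel P i j → IsParallel P i (P.reflectionPerm i j) := by
    rintro j ⟨c, hc⟩
    exact ⟨-c, by rw [P.root_reflectionPerm, hc, map_smul, P.reflection_apply_self, smul_neg,
      neg_smul]⟩
  refine ⟨fun h => ?_, key j⟩
  have := key _ h
  rwa [show P.reflectionPerm i (P.reflectionPerm i j) = j from P.root.injective (by
    rw [P.root_reflectionPerm, P.root_reflectionPerm]; simp)] at this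

omit [Fintype ι] in
lemma IsParallel.reflectionPerm_eq {i j : ι} (h : IsParallel P i j) :
    P.reflectionPerm i j = P.reflectionPerm j j := by
  obtain ⟨c, hc⟩ := h
  refine P.root.injective ?_
  rw [P.root_reflectionPerm, root_neg_index, hc, map_smul, P.reflection_apply_self, smul_neg]

lemma IsRootBasis.coroot_parallel (hB : IsRootBasis P B) [P.IsRootSystem] {j : ι}
    (hj : IsPositive P B j) {b : B} (h : IsParallel P b j) :
    ∃ c : F, 0 < c ∧ P.coroot j = c • P.coroot b := by
  classical
  obtain ⟨a, ha⟩ := h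
  have h0 : ∀ b', b' ≠ b → hB.basis.repr (P.root j) b' = 0 := fun b' hb' => by
    rw [ha, map_smul, ← hB.basis_apply, Module.Basis.repr_self, Finsupp.smul_apply,
      Finsupp.single_eq_of_ne hb', smul_zero]
  refine ⟨hB.corootCoeff j b, ?_, ?_⟩
  · obtain ⟨b', hb'⟩ := hB.exists_corootCoeff_pos hj
    by_cases hbb : b' = b
    · rwa [hbb] at hb'
    · simp [corootCoeff, h0 b' hbb] at hb'
  · rw [hB.coroot_eq_sum j, Finset.sum_eq_single b]
    · intro b' _ hb'
      simp [corootCoeff, h0 b' hb']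
    · simp

/-- Root and coroot scale by inverse factors, because their pairing is always 2, and the factors
cancel in the reflection. This is what accommodates non-reduced systems. -/
lemma IsRootBasis.reflection_parallel (hB : IsRootBasis P B) [P.IsRootSystem] {j : ι} {b : B}
    (h : IsParallel P b j) : P.reflection j = P.reflection b := by
  have key : ∀ j, IsPositive P B j → IsParallel P b j → P.reflection j = P.reflection b := by
    intro j hj h
    obtain ⟨c, hc0, hc⟩ := hB.coroot_parallel hj h
    obtain ⟨a, ha⟩ := h
    have h2 := P.root_coroot_two j
    rw [ha, hc] at h2
    simp only [map_smul, LinearMap.smul_apply, P.root_coroot_two, smul_eq_mul] at h2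
    have hca : c * a = 1 := by linear_combination h2 / 2
    ext x
    rw [P.reflection_apply, P.reflection_apply, ha, RootPairing.coroot', hc]
    simp only [map_smul, LinearMap.smul_apply, smul_smul, smul_eq_mul]
    congr 2
    linear_combination (P.toLinearMap.flip (P.coroot b) x) * hca
  by_cases hj : IsPositive P B j
  · exact key j hj h
  · have h' := key _ ((hB.isPositive_neg_iff j).2 hj)
      (by rw [← h.reflectionPerm_eq]; exact IsParallel.reflectionPerm.2 h)
    rw [← h', P.reflection_reflectionPerm]
    ext x
    simp

/-- The pairing of a root with its own coroot is 2 and is a nonnegative combination of its pairings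
with simple coroots, so one of those is positive. Reflecting in that simple root lowers the height.
-/
lemma IsRootBasis.exists_coroot'_root_pos (hB : IsRootBasis P B) [P.IsRootSystem] {j : ι}
    (hj : IsPositive P B j) :
    ∃ b : B, 0 < hB.basis.repr (P.root j) b ∧ 0 < P.coroot' b (P.root j) := by
  classical
  by_contra! h
  have h1 := P.root_coroot_two j
  have h2 : P.toLinearMap (P.root j) (P.coroot j) = P.coroot' j (P.root j) := rfl
  rw [h2, hB.coroot'_eq_sum j, LinearMap.sum_apply] at h1
  have h3 : ∑ b : B, (hB.corootCoeff j b • P.coroot' b) (P.root j) ≤ 0 := by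
    refine Finset.sum_nonpos fun b _ => ?_
    rcases (hB.repr_nonneg hj b).eq_or_lt with h0 | h0
    · simp [corootCoeff, ← h0]
    · exact mul_nonpos_of_nonneg_of_nonpos (hB.corootCoeff_nonneg hj b) (h b h0)
  rw [h1] at h3
  norm_num at h3

end Roots

section WeylGroup

variable {F : Subfield ℝ} {ι M N : Type*} [AddCommGroup M] [Module F M]
  [AddCommGroup N] [Module F N] {P : RootPairing ι F M N} {B : Set ι}

/-! ### The Weyl group -/

/-- The Weyl group, acting on the ambient space of the roots. -/
abbrev Weyl (P : RootPairing ι F M N) : Type _ := Subgroup.closure (Set.range P.reflection)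

/-- The reflection in a root, as an element of the Weyl group. -/
def Weyl.refl (P : RootPairing ι F M N) (i : ι) : Weyl P :=
  ⟨P.reflection i, Subgroup.subset_closure ⟨i, rfl⟩⟩

lemma Weyl.refl_apply (i : ι) (x : M) : (Weyl.refl P i).1 x = P.reflection i x := rfl

lemma Weyl.refl_mul_self (i : ι) : Weyl.refl P i * Weyl.refl P i = 1 := by
  ext x
  simp [refl]

lemma Weyl.refl_inv (i : ι) : (Weyl.refl P i)⁻¹ = Weyl.refl P i :=
  inv_eq_of_mul_eq_one_right (refl_mul_self i)

lemma Weyl.mul_refl_mul_refl (w : Weyl P) (i : ι) : w * Weyl.refl P i * Weyl.refl P i = w := by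
  rw [mul_assoc, refl_mul_self, mul_one]

lemma Weyl.exists_perm (w : Weyl P) : ∃ σ : Equiv.Perm ι, (∀ i, w.1 (P.root i) = P.root (σ i)) ∧
    ∀ i x, P.coroot' (σ i) (w.1 x) = P.coroot' i x := by
  obtain ⟨w, hw⟩ := w
  induction hw using Subgroup.closure_induction with
  | mem w hw =>
    obtain ⟨j, rfl⟩ := hw
    refine ⟨P.reflectionPerm j, fun i => (P.root_reflectionPerm j i).symm, fun i x => ?_⟩
    rw [P.coroot'_reflection, show P.reflectionPerm j (P.reflectionPerm j i) = i from
      P.root.injective (by rw [P.root_reflectionPerm, P.root_reflectionPerm]; simp)]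
  | one => exact ⟨1, fun i => rfl, fun i x => rfl⟩
  | mul a b _ _ ha hb =>
    obtain ⟨σ, h1, h2⟩ := ha
    obtain ⟨τ, h3, h4⟩ := hb
    refine ⟨σ * τ, fun i => ?_, fun i x => ?_⟩
    · have h5 := h1 (τ i)
      have h6 := h3 i
      simp only at h5 h6 ⊢
      rw [LinearEquiv.mul_apply, h6, h5, Equiv.Perm.mul_apply]
    · have h5 := h2 (τ i) (b x)
      have h6 := h4 i x
      simp only at h5 h6 ⊢
      rw [LinearEquiv.mul_apply, Equiv.Perm.mul_apply, h5, h6]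
  | inv a _ ha =>
    obtain ⟨σ, h1, h2⟩ := ha
    refine ⟨σ.symm, fun i => ?_, fun i x => ?_⟩
    · have h := h1 (σ.symm i)
      simp only [Equiv.apply_symm_apply] at h ⊢
      rw [← h]
      exact a.symm_apply_apply _
    · have h := h2 (σ.symm i) (a⁻¹ x)
      simp only [Equiv.apply_symm_apply] at h ⊢
      rw [← h, show a (a⁻¹ x) = x from a.apply_symm_apply x]

/-- The permutation of the roots induced by an element of the Weyl group. -/
def Weyl.perm (w : Weyl P) : Equiv.Perm ι := w.exists_perm.choose

lemma Weyl.root_perm (w : Weyl P) (i : ι) : P.root (w.perm i) = w.1 (P.root i) :=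
  (w.exists_perm.choose_spec.1 i).symm

lemma Weyl.coroot'_perm (w : Weyl P) (i : ι) (x : M) :
    P.coroot' (w.perm i) (w.1 x) = P.coroot' i x :=
  w.exists_perm.choose_spec.2 i x

lemma Weyl.perm_mul_apply (v w : Weyl P) (i : ι) : (v * w).perm i = v.perm (w.perm i) :=
  P.root.injective (by simp only [root_perm]; rfl)

lemma Weyl.perm_one_apply (i : ι) : (1 : Weyl P).perm i = i :=
  P.root.injective (by simp only [root_perm]; rfl)

lemma Weyl.perm_refl_apply (i j : ι) : (Weyl.refl P i).perm j = P.reflectionPerm i j :=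
  P.root.injective (by rw [root_perm, P.root_reflectionPerm]; rfl)

lemma Weyl.perm_perm_inv (w : Weyl P) (i : ι) : w.perm (w⁻¹.perm i) = i := by
  rw [← perm_mul_apply, mul_inv_cancel, perm_one_apply]

lemma Weyl.perm_neg (w : Weyl P) (i : ι) :
    w.perm (P.reflectionPerm i i) = P.reflectionPerm (w.perm i) (w.perm i) :=
  P.root.injective (by rw [root_perm, root_neg_index, root_neg_index, map_neg, root_perm])

lemma Weyl.refl_perm (w : Weyl P) (i : ι) :
    Weyl.refl P (w.perm i) = w * Weyl.refl P i * w⁻¹ := by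
  refine Subtype.ext (LinearEquiv.ext fun x => ?_)
  have hx : w.1 (w⁻¹.1 x) = x := w.1.apply_symm_apply x
  change P.reflection _ x = w.1 (P.reflection i (w⁻¹.1 x))
  rw [P.reflection_apply, P.reflection_apply, map_sub, map_smul, hx, root_perm]
  conv_lhs => rw [← hx, coroot'_perm, hx]

lemma IsRootBasis.isPositive_iff_of_root_eq (hB : IsRootBasis P B) [P.IsRootSystem] {i j : ι}
    {c : F} (hc : 0 < c) (h : P.root j = c • P.root i) : IsPositive P B j ↔ IsPositive P B i := by
  rw [hB.isPositive_iff, hB.isPositive_iff, h]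
  refine forall_congr' fun b => ?_
  rw [map_smul, Finsupp.smul_apply, smul_eq_mul, mul_nonneg_iff_of_pos_left hc]

lemma IsRootBasis.isParallel_coeff_pos (hB : IsRootBasis P B) [P.IsRootSystem] {j : ι}
    (hj : IsPositive P B j) {b : B} {c : F} (h : P.root j = c • P.root b) : 0 < c := by
  have h0 := hB.repr_nonneg hj b
  rw [h, map_smul, ← hB.basis_apply, Module.Basis.repr_self, Finsupp.smul_apply,
    Finsupp.single_eq_same, smul_eq_mul, mul_one] at h0
  refine h0.lt_of_ne' fun hc => P.ne_zero j ?_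
  rw [h, hc, zero_smul]

lemma IsRootBasis.isPositive_perm_iff_of_isParallel (hB : IsRootBasis P B) [P.IsRootSystem] {j : ι}
    (hj : IsPositive P B j) {b : B} (h : IsParallel P b j) (w : Weyl P) :
    IsPositive P B (w.perm j) ↔ IsPositive P B (w.perm b) := by
  obtain ⟨c, hc⟩ := h
  exact hB.isPositive_iff_of_root_eq (hB.isParallel_coeff_pos hj hc)
    (by rw [w.root_perm, w.root_perm, hc, map_smul])

variable [Fintype ι]

/-! ### Inversions -/

open Classical in
/-- The number of positive roots made negative by `w`. -/
def inversionCount (B : Set ι) (w : Weyl P) : ℕ :=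
  Finset.card {j : ι | IsPositive P B j ∧ ¬ IsPositive P B (w.perm j)}

open Classical in
/-- The number of positive multiples of the root `i` among the roots. -/
def parallelCount (P : RootPairing ι F M N) (B : Set ι) (i : ι) : ℕ :=
  Finset.card {j : ι | IsPositive P B j ∧ IsParallel P i j}

lemma inversionCount_one : inversionCount B (1 : Weyl P) = 0 := by
  classical
  rw [inversionCount, Finset.card_eq_zero, Finset.filter_eq_empty_iff]
  rintro j - ⟨h1, h2⟩
  rw [Weyl.perm_one_apply] at h2
  exact h2 h1

lemma IsRootBasis.parallelCount_pos (b : B) : 0 < parallelCount P B b := by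
  classical
  exact Finset.card_pos.2 ⟨b, Finset.mem_filter.2
    ⟨Finset.mem_univ _, IsRootBasis.isPositive_of_mem b.2, isParallel_self _⟩⟩

lemma IsRootBasis.isPositive_perm (hB : IsRootBasis P B) [P.IsRootSystem] {w : Weyl P}
    (hw : ∀ b ∈ B, IsPositive P B (w.perm b)) {j : ι} (hj : IsPositive P B j) :
    IsPositive P B (w.perm j) := by
  classical
  rw [hB.isPositive_iff]
  intro b
  rw [w.root_perm, hB.root_eq_sum j, map_sum, map_sum, Finsupp.finsetSum_apply]
  refine Finset.sum_nonneg fun b' _ => ?_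
  rw [map_smul, map_smul, Finsupp.smul_apply, ← w.root_perm]
  exact mul_nonneg (hB.repr_nonneg hj b') (hB.repr_nonneg (hw b' b'.2) b)

lemma IsRootBasis.not_isPositive_perm (hB : IsRootBasis P B) [P.IsRootSystem] {w : Weyl P}
    (hw : ∀ b ∈ B, ¬ IsPositive P B (w.perm b)) {j : ι} (hj : IsPositive P B j) :
    ¬ IsPositive P B (w.perm j) := by
  classical
  rw [← hB.isPositive_neg_iff, hB.isPositive_iff]
  intro b
  rw [root_neg_index, w.root_perm, hB.root_eq_sum j, map_sum, ← Finset.sum_neg_distrib, map_sum,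
    Finsupp.finsetSum_apply]
  refine Finset.sum_nonneg fun b' _ => ?_
  rw [map_smul, ← w.root_perm, ← smul_neg, ← root_neg_index, map_smul, Finsupp.smul_apply]
  exact mul_nonneg (hB.repr_nonneg hj b')
    (hB.repr_nonneg ((hB.isPositive_neg_iff _).2 (hw b' b'.2)) b)

lemma IsRootBasis.exists_not_isPositive_perm (hB : IsRootBasis P B) [P.IsRootSystem] {w : Weyl P}
    (hw : inversionCount B w ≠ 0) : ∃ b : B, ¬ IsPositive P B (w.perm b) := by
  classical
  by_contra! h
  refine hw ?_
  rw [inversionCount, Finset.card_eq_zero, Finset.filter_eq_empty_iff]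
  rintro j - ⟨h1, h2⟩
  exact h2 (hB.isPositive_perm (fun b hb => h ⟨b, hb⟩) h1)

/-- The reflection in `b` permutes the positive roots not parallel to `b`, which matches the
inversions among them. The positive multiples of `b` all become inversions, and none was one before.
-/
lemma IsRootBasis.inversionCount_mul_refl (hB : IsRootBasis P B) [P.IsRootSystem] {w : Weyl P}
    {b : B} (hw : IsPositive P B (w.perm b)) :
    inversionCount B (w * Weyl.refl P b) = inversionCount B w + parallelCount P B b := by
  classical
  have hinv : ∀ j, P.reflectionPerm b (P.reflectionPerm b j) = j := fun j =>
    P.root.injective (by rw [P.root_reflectionPerm, P.root_reflectionPerm]; simp)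
  unfold inversionCount parallelCount
  rw [add_comm, ← Finset.card_filter_add_card_filter_not (p := fun j => IsParallel P b j),
    Finset.filter_filter, Finset.filter_filter]
  congr 1
  · congr 1
    refine Finset.filter_congr fun j _ => ?_
    refine ⟨fun h => ⟨h.1.1, h.2⟩, fun h => ⟨⟨h.1, ?_⟩, h.2⟩⟩
    rw [Weyl.perm_mul_apply, Weyl.perm_refl_apply, h.2.reflectionPerm_eq, Weyl.perm_neg,
      hB.isPositive_neg_iff, not_not, hB.isPositive_perm_iff_of_isParallel h.1 h.2]
    exact hw
  · refine Finset.card_nbij' (P.reflectionPerm b) (P.reflectionPerm b) ?_ ?_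
      (fun j _ => hinv j) (fun j _ => hinv j)
    · intro j hj
      simp only [Finset.coe_filter, Finset.mem_univ, true_and, Set.mem_ofPred_eq] at hj ⊢
      rw [Weyl.perm_mul_apply, Weyl.perm_refl_apply] at hj
      exact ⟨hB.isPositive_reflectionPerm hj.1.1 hj.2, hj.1.2⟩
    · intro j hj
      simp only [Finset.coe_filter, Finset.mem_univ, true_and, Set.mem_ofPred_eq] at hj ⊢
      have hpar : ¬ IsParallel P b j := fun h =>
        hj.2 ((hB.isPositive_perm_iff_of_isParallel hj.1 h w).2 hw)
      rw [Weyl.perm_mul_apply, Weyl.perm_refl_apply, hinv, IsParallel.reflectionPerm]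
      exact ⟨⟨hB.isPositive_reflectionPerm hj.1 hpar, hj.2⟩, hpar⟩

omit [Fintype ι] in
lemma IsRootBasis.isPositive_perm_mul_refl (hB : IsRootBasis P B) {w : Weyl P}
    {b : B} : IsPositive P B ((w * Weyl.refl P b).perm b) ↔ ¬ IsPositive P B (w.perm b) := by
  rw [Weyl.perm_mul_apply, Weyl.perm_refl_apply, Weyl.perm_neg, hB.isPositive_neg_iff]

lemma IsRootBasis.inversionCount_mul_refl_add (hB : IsRootBasis P B) [P.IsRootSystem] {w : Weyl P}
    {b : B} (hw : ¬ IsPositive P B (w.perm b)) :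
    inversionCount B (w * Weyl.refl P b) + parallelCount P B b = inversionCount B w := by
  rw [← hB.inversionCount_mul_refl (hB.isPositive_perm_mul_refl.2 hw), Weyl.mul_refl_mul_refl]

lemma IsRootBasis.inversionCount_mul_refl_le (hB : IsRootBasis P B) [P.IsRootSystem] (w : Weyl P)
    (b : B) : inversionCount B (w * Weyl.refl P b) ≤ inversionCount B w + parallelCount P B b := by
  by_cases hw : IsPositive P B (w.perm b)
  · exact (hB.inversionCount_mul_refl hw).le
  · have := hB.inversionCount_mul_refl_add hw
    omega

omit [Fintype ι] in
lemma Weyl.refl_ne_one (hB : IsRootBasis P B) (b : B) : Weyl.refl P b ≠ 1 := by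
  intro h
  have h1 := hB.isPositive_perm_mul_refl (w := 1) (b := b)
  rw [one_mul, h, Weyl.perm_one_apply] at h1
  have h2 := IsRootBasis.isPositive_of_mem (P := P) b.2
  exact h1.1 h2 h2

/-! ### Generation by simple reflections -/

/-- The product of the simple reflections in a list. -/
def simpleProd (P : RootPairing ι F M N) (l : List B) : Weyl P :=
  (l.map fun b => Weyl.refl P b).prod

omit [Fintype ι] in
lemma simpleProd_append (l l' : List B) :
    simpleProd P (l ++ l') = simpleProd P l * simpleProd P l' := by
  simp [simpleProd]

omit [Fintype ι] in
lemma simpleProd_cons (b : B) (l : List B) :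
    simpleProd P (b :: l) = Weyl.refl P b * simpleProd P l := by
  simp [simpleProd]

omit [Fintype ι] in
lemma simpleProd_singleton (b : B) : simpleProd P [b] = Weyl.refl P b := by
  simp [simpleProd]

lemma IsRootBasis.exists_simpleProd_refl_of_isPositive (hB : IsRootBasis P B) [P.IsRootSystem]
    {j : ι} (hj : IsPositive P B j) : ∃ l : List B, simpleProd P l = Weyl.refl P j := by
  classical
  let ht : ι → F := fun j => ∑ b : B, hB.basis.repr (P.root j) b
  -- Heights take values in the field `F`, which is not well ordered; the induction is well founded
  -- because there are finitely many roots.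
  have hwf : WellFounded (InvImage (· < ·) ht) := by
    have : IsTrans ι (InvImage (· < ·) ht) := ⟨fun a b c h1 h2 => lt_trans h1 h2⟩
    have : Std.Irrefl (InvImage (· < ·) ht) := ⟨fun a h => lt_irrefl _ h⟩
    exact Finite.wellFounded_of_trans_of_irrefl _
  induction j using hwf.induction with
  | _ j ih =>
    obtain ⟨b, -, hb⟩ := hB.exists_coroot'_root_pos hj
    by_cases hpar : IsParallel P b j
    · exact ⟨[b], by rw [simpleProd_singleton]; exact Subtype.ext (hB.reflection_parallel hpar).symm⟩
    · obtain ⟨l, hl⟩ := ih (P.reflectionPerm b j) (by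
        change ∑ b' : B, _ < ∑ b' : B, _
        rw [P.root_reflectionPerm, P.reflection_apply]
        refine Finset.sum_lt_sum (fun b' _ => ?_) ⟨b, Finset.mem_univ _, ?_⟩
        · rw [map_sub, map_smul, ← hB.basis_apply, Module.Basis.repr_self, Finsupp.sub_apply,
            Finsupp.smul_apply, sub_le_self_iff]
          refine mul_nonneg hb.le ?_
          rw [Finsupp.single_apply]
          split_ifs <;> simp
        · rw [map_sub, map_smul, ← hB.basis_apply, Module.Basis.repr_self, Finsupp.sub_apply,
            Finsupp.smul_apply, Finsupp.single_eq_same, smul_eq_mul, mul_one]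
          exact sub_lt_self _ hb) (hB.isPositive_reflectionPerm hj hpar)
      refine ⟨[b] ++ l ++ [b], ?_⟩
      rw [simpleProd_append, simpleProd_append, simpleProd_singleton, hl, ← Weyl.perm_refl_apply,
        Weyl.refl_perm, Weyl.refl_inv, ← mul_assoc, ← mul_assoc, Weyl.refl_mul_self, one_mul,
        Weyl.mul_refl_mul_refl]

lemma IsRootBasis.exists_simpleProd (hB : IsRootBasis P B) [P.IsRootSystem] (w : Weyl P) :
    ∃ l : List B, simpleProd P l = w := by
  have hrefl : ∀ j, ∃ l : List B, simpleProd P l = Weyl.refl P j := by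
    intro j
    by_cases hj : IsPositive P B j
    · exact hB.exists_simpleProd_refl_of_isPositive hj
    · obtain ⟨l, hl⟩ := hB.exists_simpleProd_refl_of_isPositive ((hB.isPositive_neg_iff j).2 hj)
      refine ⟨l, hl.trans (Subtype.ext ?_)⟩
      change P.reflection _ = P.reflection _
      rw [P.reflection_reflectionPerm]
      ext x
      simp
  obtain ⟨w, hw⟩ := w
  induction hw using Subgroup.closure_induction with
  | mem w hw =>
    obtain ⟨j, rfl⟩ := hw
    exact hrefl j
  | one => exact ⟨[], rfl⟩
  | mul a b _ _ ha hb =>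
    obtain ⟨l, hl⟩ := ha
    obtain ⟨l', hl'⟩ := hb
    exact ⟨l ++ l', by rw [simpleProd_append, hl, hl']; rfl⟩
  | inv a _ ha =>
    obtain ⟨l, hl⟩ := ha
    refine ⟨l.reverse, ?_⟩
    have h : simpleProd P l.reverse * simpleProd P l = 1 := by
      clear hl
      induction l with
      | nil => simp [simpleProd]
      | cons b l ih =>
        rw [List.reverse_cons, simpleProd_append, simpleProd_singleton, simpleProd_cons,
          mul_assoc, ← mul_assoc (Weyl.refl P b), Weyl.refl_mul_self, one_mul, ih]
    rw [eq_inv_of_mul_eq_one_left h, hl]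
    rfl

/-- Read the word from the right. The letter at which the image of `b` first turns negative is
parallel to that image, so the trailing reflection conjugates into this letter and cancels it. -/
lemma IsRootBasis.exchange (hB : IsRootBasis P B) [P.IsRootSystem] (l : List B) {b : B}
    (h : ¬ IsPositive P B ((simpleProd P l).perm b)) :
    ∃ l' : List B, l'.length + 1 = l.length ∧
      simpleProd P l * Weyl.refl P b = simpleProd P l' := by
  induction l with
  | nil =>
    refine absurd (IsRootBasis.isPositive_of_mem (P := P) b.2) ?_
    simpa [simpleProd, Weyl.perm_one_apply] using h
  | cons a l ih =>
    by_cases hl : IsPositive P B ((simpleProd P l).perm b)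
    · refine ⟨l, rfl, ?_⟩
      have hpar : IsParallel P a ((simpleProd P l).perm b) := by
        by_contra hpar
        rw [simpleProd_cons, Weyl.perm_mul_apply, Weyl.perm_refl_apply] at h
        exact h (hB.isPositive_reflectionPerm hl hpar)
      have h1 : Weyl.refl P ((simpleProd P l).perm b) = Weyl.refl P a :=
        Subtype.ext (hB.reflection_parallel hpar)
      rw [simpleProd_cons, ← h1, Weyl.refl_perm, inv_mul_cancel_right, Weyl.mul_refl_mul_refl]
    · obtain ⟨l', h1, h2⟩ := ih hl
      exact ⟨a :: l', by simp [h1], by rw [simpleProd_cons, simpleProd_cons, mul_assoc, h2]⟩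

/-- Suppose a shortest word for `w` ends in `b`. Since `w` keeps `b` positive, the word without its
last letter makes `b` negative, and the exchange property produces a shorter word. -/
lemma IsRootBasis.eq_one_of_isPositive_perm (hB : IsRootBasis P B) [P.IsRootSystem] {w : Weyl P}
    (hw : ∀ b ∈ B, IsPositive P B (w.perm b)) : w = 1 := by
  classical
  obtain ⟨n, hn, hmin⟩ : ∃ n, (∃ l : List B, l.length = n ∧ simpleProd P l = w) ∧
      ∀ m < n, ¬ ∃ l : List B, l.length = m ∧ simpleProd P l = w := by
    obtain ⟨l, hl⟩ := hB.exists_simpleProd w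
    have h : ∃ n, ∃ l : List B, l.length = n ∧ simpleProd P l = w := ⟨_, l, rfl, hl⟩
    exact ⟨Nat.find h, Nat.find_spec h, fun m hm => Nat.find_min h hm⟩
  obtain ⟨l, hln, hl⟩ := hn
  rcases List.eq_nil_or_concat l with rfl | ⟨l', b, rfl⟩
  · rw [← hl]; rfl
  · rw [List.concat_eq_append, simpleProd_append, simpleProd_singleton] at hl
    have h := hw b b.2
    rw [← hl, hB.isPositive_perm_mul_refl] at h
    obtain ⟨l'', h1, h2⟩ := hB.exchange l' h
    refine absurd ⟨l'', rfl, ?_⟩ (hmin l''.length ?_)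
    · rw [← hln, List.length_concat]
      omega
    · rw [← h2, hl]

lemma IsRootBasis.eq_one_of_inversionCount_eq_zero (hB : IsRootBasis P B) [P.IsRootSystem]
    {w : Weyl P} (hw : inversionCount B w = 0) : w = 1 := by
  classical
  refine hB.eq_one_of_isPositive_perm fun b hb => by_contra fun h => ?_
  rw [inversionCount, Finset.card_eq_zero, Finset.filter_eq_empty_iff] at hw
  exact hw (Finset.mem_univ b) ⟨IsRootBasis.isPositive_of_mem hb, h⟩

/-- Induction along minimal galleries. -/
lemma IsRootBasis.weyl_induction (hB : IsRootBasis P B) [P.IsRootSystem] {p : Weyl P → Prop}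
    (one : p 1)
    (mul_refl : ∀ w (b : B), IsPositive P B (w.perm b) → p w → p (w * Weyl.refl P b))
    (w : Weyl P) : p w := by
  induction hn : inversionCount B w using Nat.strong_induction_on generalizing w with
  | _ n ih =>
    by_cases h0 : inversionCount B w = 0
    · rw [hB.eq_one_of_inversionCount_eq_zero h0]
      exact one
    · obtain ⟨b, hb⟩ := hB.exists_not_isPositive_perm h0
      have h1 := hB.inversionCount_mul_refl_add hb
      have h2 := IsRootBasis.parallelCount_pos (P := P) b
      have h3 := mul_refl _ b (hB.isPositive_perm_mul_refl.2 hb) (ih _ (by omega) _ rfl)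
      rwa [Weyl.mul_refl_mul_refl] at h3

/-- The longest element of the Weyl group. -/
lemma IsRootBasis.exists_longest (hB : IsRootBasis P B) [P.IsRootSystem] :
    ∃ w : Weyl P, ∀ j, IsPositive P B j → ¬ IsPositive P B (w.perm j) := by
  classical
  have hbd : ∀ w : Weyl P, inversionCount B w ≤ Fintype.card ι := fun w => Finset.card_le_univ _
  obtain ⟨n, ⟨w, hw⟩, hmax⟩ : ∃ n, (∃ w : Weyl P, inversionCount B w = n) ∧
      ∀ w : Weyl P, inversionCount B w ≤ n := by
    have h : ∃ n, ∀ w : Weyl P, inversionCount B w ≤ n := ⟨_, hbd⟩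
    refine ⟨Nat.find h, ?_, Nat.find_spec h⟩
    by_contra! hne
    have h1 : ∀ w : Weyl P, inversionCount B w ≤ Nat.find h - 1 := fun w => by
      have := Nat.find_spec h w
      have := hne w
      omega
    have h2 := Nat.find_min' h h1
    have h3 := hne 1
    rw [inversionCount_one] at h3
    omega
  refine ⟨w, fun j hj => hB.not_isPositive_perm (fun b hb h => ?_) hj⟩
  have h1 := hB.inversionCount_mul_refl (b := ⟨b, hb⟩) h
  have h2 := IsRootBasis.parallelCount_pos (P := P) (⟨b, hb⟩ : B)
  have h3 := hmax (w * Weyl.refl P b)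
  simp only at h1 h2
  omega

end WeylGroup

/-! ### Longest element, panels, and separation of Weyl orbits by distances -/

section WeylGeometry

variable {F : Subfield ℝ} {ι M N : Type*} [AddCommGroup M] [Module F M]
  [AddCommGroup N] [Module F N] {P : RootPairing ι F M N} {B : Set ι}

/-- `w` maps every positive root to a negative one. -/
def IsLongest (B : Set ι) (w : Weyl P) : Prop :=
  ∀ j, IsPositive P B j → ¬ IsPositive P B (w.perm j)

variable [Fintype ι]

lemma IsLongest.mul_self (hB : IsRootBasis P B) [P.IsRootSystem] {w : Weyl P}
    (hw : IsLongest B w) : w * w = 1 := by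
  refine hB.eq_one_of_isPositive_perm fun b hb => ?_
  have h1 := hw b (IsRootBasis.isPositive_of_mem hb)
  rw [← hB.isPositive_neg_iff] at h1
  have h2 := hw _ h1
  rw [← Weyl.perm_neg, ← Weyl.perm_mul_apply, Weyl.perm_neg, hB.isPositive_neg_iff, not_not] at h2
  exact h2

lemma IsLongest.inversionCount_lt {w v : Weyl P} (hw : IsLongest B w) {j : ι}
    (hj : IsPositive P B j) (hvj : IsPositive P B (v.perm j)) :
    inversionCount B v < inversionCount B w := by
  classical
  refine Finset.card_lt_card ⟨fun i hi => ?_, fun h => ?_⟩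
  · simp only [Finset.mem_filter] at hi ⊢
    exact ⟨hi.1, hi.2.1, hw i hi.2.1⟩
  · have := h (Finset.mem_filter.2 ⟨Finset.mem_univ j, hj, hw j hj⟩)
    exact (Finset.mem_filter.1 this).2.2 hvj

/-- The element `s_b w` sends the positive root `-w b` to `b`, so it keeps some simple root `b'`
positive. Then `-w b'` is a positive root made negative by `s_b`, hence a multiple of `b`, and
conjugation by `w` exchanges the two reflections. -/
lemma IsLongest.exists_mul_refl (hB : IsRootBasis P B) [P.IsRootSystem] {w : Weyl P}
    (hw : IsLongest B w) (b : B) : ∃ b' : B, Weyl.refl P b * w = w * Weyl.refl P b' := by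
  have hbpos : IsPositive P B b := IsRootBasis.isPositive_of_mem b.2
  have hww := hw.mul_self hB
  obtain ⟨b', hb'⟩ : ∃ b' : B, IsPositive P B ((Weyl.refl P b * w).perm b') := by
    by_contra! h
    have h1 : ¬ IsPositive P B (w.perm b) := hw b hbpos
    rw [← hB.isPositive_neg_iff, ← Weyl.perm_neg] at h1
    have h2 := hB.not_isPositive_perm (w := Weyl.refl P b * w) (fun b' hb' => h ⟨b', hb'⟩) h1
    rw [Weyl.perm_mul_apply, ← Weyl.perm_mul_apply w w, hww, Weyl.perm_one_apply, Weyl.perm_neg,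
      hB.isPositive_neg_iff, not_not, Weyl.perm_refl_apply, hB.isPositive_neg_iff] at h2
    exact h2 hbpos
  refine ⟨b', ?_⟩
  have h1 := hw b' (IsRootBasis.isPositive_of_mem b'.2)
  have hpar : IsParallel P b (P.reflectionPerm (w.perm b') (w.perm b')) := by
    by_contra hpar
    rw [← hB.isPositive_neg_iff] at h1
    have h2 := hB.isPositive_reflectionPerm h1 hpar
    rw [← Weyl.perm_refl_apply, Weyl.perm_neg, ← Weyl.perm_mul_apply, hB.isPositive_neg_iff] at h2
    exact h2 hb'
  have h3 : Weyl.refl P (w.perm b') = Weyl.refl P b := by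
    refine Subtype.ext (Eq.trans ?_ (hB.reflection_parallel hpar))
    change P.reflection _ = P.reflection _
    rw [P.reflection_reflectionPerm]
    ext x
    simp
  rw [← h3, Weyl.refl_perm, inv_mul_cancel_right]

/-- The vector `x` lies in the closed fundamental chamber. -/
def IsDominant (P : RootPairing ι F M N) (B : Set ι) (x : M) : Prop :=
  ∀ i, IsPositive P B i → 0 ≤ P.coroot' i x

omit [Fintype ι] in
lemma coroot'_neg_index (i : ι) (x : M) :
    P.coroot' (P.reflectionPerm i i) x = -P.coroot' i x := by
  simp [P.coroot_reflectionPerm]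

/-- Every orbit of the Weyl group meets the fundamental chamber at most once. -/
lemma IsDominant.apply_eq (hB : IsRootBasis P B) [P.IsRootSystem] {w : Weyl P} {x : M}
    (hx : IsDominant P B x) (hwx : IsDominant P B (w.1 x)) : w.1 x = x := by
  induction w using hB.weyl_induction generalizing x with
  | one => rfl
  | mul_refl w b hwb ih =>
    have hb := hx b (IsRootBasis.isPositive_of_mem b.2)
    have h1 : ¬ IsPositive P B ((w * Weyl.refl P b).perm b) := by
      rw [hB.isPositive_perm_mul_refl, not_not]
      exact hwb
    have h2 := hwx _ ((hB.isPositive_neg_iff _).2 h1)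
    rw [coroot'_neg_index, Weyl.coroot'_perm] at h2
    have h0 : P.coroot' b x = 0 := by linarith
    have hs : (Weyl.refl P b).1 x = x := by
      rw [Weyl.refl_apply, P.reflection_apply, h0, zero_smul, sub_zero]
    have hmul : (w * Weyl.refl P b).1 x = w.1 x := by
      change w.1 ((Weyl.refl P b).1 x) = w.1 x
      rw [hs]
    rw [hmul] at hwx ⊢
    exact ih hx hwx

lemma IsRootBasis.exists_faceVector (hB : IsRootBasis P B) [P.IsRootSystem] (b : B) :
    ∃ y : M, P.coroot' b y = 0 ∧ ∀ j, IsPositive P B j → ¬ IsParallel P b j →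
      0 < P.coroot' j y := by
  classical
  obtain ⟨y, hy⟩ := hB.exists_coroot'_eq (fun b' => if b' = b then 0 else 1)
  refine ⟨y, by simp [hy b], fun j hj hpar => ?_⟩
  obtain ⟨b', hne, hb'⟩ := hB.exists_repr_pos_ne hj hpar
  rw [hB.coroot'_eq_sum, LinearMap.sum_apply]
  refine Finset.sum_pos' (fun c _ => mul_nonneg (hB.corootCoeff_nonneg hj c) ?_)
    ⟨b', Finset.mem_univ _, mul_pos (div_pos (mul_pos hb' (rootForm_root_pos _))
      (rootForm_root_pos _)) ?_⟩
  · rw [hy]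
    split_ifs <;> simp
  · rw [hy, if_neg hne]
    exact one_pos

/-- A vector in the relative interior of the panel of the fundamental chamber of type `b`. -/
def IsRootBasis.faceVector (hB : IsRootBasis P B) [P.IsRootSystem] (b : B) : M :=
  (hB.exists_faceVector b).choose

lemma IsRootBasis.coroot'_faceVector_self (hB : IsRootBasis P B) [P.IsRootSystem] (b : B) :
    P.coroot' b (hB.faceVector b) = 0 :=
  (hB.exists_faceVector b).choose_spec.1

lemma IsRootBasis.coroot'_faceVector_pos (hB : IsRootBasis P B) [P.IsRootSystem] {b : B} {j : ι}
    (hj : IsPositive P B j) (h : ¬ IsParallel P b j) : 0 < P.coroot' j (hB.faceVector b) :=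
  (hB.exists_faceVector b).choose_spec.2 j hj h

lemma IsRootBasis.isDominant_faceVector (hB : IsRootBasis P B) [P.IsRootSystem] (b : B) :
    IsDominant P B (hB.faceVector b) := by
  intro j hj
  by_cases h : IsParallel P b j
  · obtain ⟨c, -, hc⟩ := hB.coroot_parallel hj h
    have h0 := hB.coroot'_faceVector_self b
    rw [RootPairing.coroot', hc, map_smul, LinearMap.smul_apply, h0, smul_zero]
  · exact (hB.coroot'_faceVector_pos hj h).le

lemma IsRootBasis.refl_faceVector (hB : IsRootBasis P B) [P.IsRootSystem] (b : B) :
    (Weyl.refl P b).1 (hB.faceVector b) = hB.faceVector b := by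
  rw [Weyl.refl_apply, P.reflection_apply, hB.coroot'_faceVector_self, zero_smul, sub_zero]

/-- The stabilizer of a point in the relative interior of a panel. -/
lemma IsRootBasis.eq_one_or_refl_of_faceVector (hB : IsRootBasis P B) [P.IsRootSystem] {b : B}
    {w : Weyl P} (hw : w.1 (hB.faceVector b) = hB.faceVector b) : w = 1 ∨ w = Weyl.refl P b := by
  have key : ∀ w : Weyl P, w.1 (hB.faceVector b) = hB.faceVector b →
      IsPositive P B (w.perm b) → w = 1 := by
    intro w hw hwb
    refine hB.eq_one_of_isPositive_perm fun c hc => ?_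
    have hc := IsRootBasis.isPositive_of_mem (P := P) hc
    by_cases hpar : IsParallel P b c
    · exact (hB.isPositive_perm_iff_of_isParallel hc hpar w).2 hwb
    · by_contra hneg
      have h1 := hB.isDominant_faceVector b _ ((hB.isPositive_neg_iff _).2 hneg)
      have h2 := hB.coroot'_faceVector_pos hc hpar
      rw [coroot'_neg_index, ← hw, Weyl.coroot'_perm] at h1
      linarith
  by_cases hwb : IsPositive P B (w.perm b)
  · exact Or.inl (key w hw hwb)
  · right
    have h1 := key (w * Weyl.refl P b) (by
      change w.1 ((Weyl.refl P b).1 _) = _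
      rw [hB.refl_faceVector, hw]) (hB.isPositive_perm_mul_refl.2 hwb)
    rw [← Weyl.mul_refl_mul_refl w b, h1, one_mul]

/-! ### The norm -/

open Classical in
/-- The norm `∑_{α ∈ R⁺} |⟨x, α^∨⟩|` on the ambient space of the roots. -/
def rootNorm (P : RootPairing ι F M N) (B : Set ι) (x : M) : F :=
  ∑ i with IsPositive P B i, |P.coroot' i x|

open Classical in
/-- The functional `∑_{α ∈ R⁺} α^∨`. -/
def corootSum (P : RootPairing ι F M N) (B : Set ι) (x : M) : F :=
  ∑ i with IsPositive P B i, P.coroot' i x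

/-- The reflection in `b` permutes the positive coroots not parallel to `b` and negates their values
at the root `b`, so these cancel. Only the multiples of `b` contribute. -/
lemma IsRootBasis.corootSum_simple_pos (hB : IsRootBasis P B) [P.IsRootSystem] (b : B) :
    0 < corootSum P B (P.root b) := by
  classical
  have h2 : P.coroot' b (P.root b) = 2 := P.root_coroot_two b
  rw [corootSum, ← Finset.sum_filter_add_sum_filter_not _ (fun j => IsParallel P b j),
    Finset.filter_filter, Finset.filter_filter]
  refine add_pos_of_pos_of_nonneg (Finset.sum_pos (fun j hj => ?_) ?_) (le_of_eq ?_)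
  · simp only [Finset.mem_filter, Finset.mem_univ, true_and] at hj
    obtain ⟨c, hc0, hc⟩ := hB.coroot_parallel hj.1 hj.2
    rw [RootPairing.coroot', hc, map_smul, LinearMap.smul_apply, h2]
    exact mul_pos hc0 two_pos
  · exact ⟨b, Finset.mem_filter.2 ⟨Finset.mem_univ _, IsRootBasis.isPositive_of_mem b.2,
      isParallel_self _⟩⟩
  · have h : ∀ S : F, S = -S → 0 = S := fun S hS => by linarith
    refine h _ ?_
    rw [← Finset.sum_neg_distrib]
    have hinv : ∀ j, P.reflectionPerm b (P.reflectionPerm b j) = j := fun j =>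
      P.root.injective (by rw [P.root_reflectionPerm, P.root_reflectionPerm]; simp)
    refine Finset.sum_nbij' (P.reflectionPerm b) (P.reflectionPerm b) ?_ ?_
      (fun j _ => hinv j) (fun j _ => hinv j) ?_
    · intro j hj
      simp only [Finset.mem_filter, Finset.mem_univ, true_and] at hj ⊢
      exact ⟨hB.isPositive_reflectionPerm hj.1 hj.2, by rw [IsParallel.reflectionPerm]; exact hj.2⟩
    · intro j hj
      simp only [Finset.mem_filter, Finset.mem_univ, true_and] at hj ⊢
      exact ⟨hB.isPositive_reflectionPerm hj.1 hj.2, by rw [IsParallel.reflectionPerm]; exact hj.2⟩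
    · intro j _
      rw [← P.coroot'_reflection, P.reflection_apply_self, map_neg, neg_neg]

lemma IsRootBasis.corootSum_pos (hB : IsRootBasis P B) [P.IsRootSystem] {i : ι}
    (hi : IsPositive P B i) : 0 < corootSum P B (P.root i) := by
  classical
  have h : corootSum P B (P.root i) =
      ∑ b : B, hB.basis.repr (P.root i) b * corootSum P B (P.root b) := by
    unfold corootSum
    simp_rw [Finset.mul_sum]
    rw [Finset.sum_comm]
    refine Finset.sum_congr rfl fun j _ => ?_
    conv_lhs => rw [hB.root_eq_sum i, map_sum]
    simp only [map_smul, smul_eq_mul]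
  rw [h]
  obtain ⟨b, hb⟩ := hB.exists_repr_pos hi
  exact Finset.sum_pos' (fun b _ => mul_nonneg (hB.repr_nonneg hi b)
    (hB.corootSum_simple_pos b).le) ⟨b, Finset.mem_univ _, mul_pos hb (hB.corootSum_simple_pos b)⟩

/-- The kinks of `τ ↦ ∑ |τ z - a|` determine the ratios `a / z`. -/
lemma exists_eq_mul_of_sum_abs_eq {κ K : Type*} [Field K] [LinearOrder K] [IsStrictOrderedRing K]
    (s : Finset κ) (z a c : κ → K) (hz : ∀ k ∈ s, 0 < z k)
    (h : ∀ τ, 0 ≤ τ → ∑ k ∈ s, |τ * z k - a k| = ∑ k ∈ s, |τ * z k - c k|) {j : κ} (hj : j ∈ s)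
    {τ : K} (hτ : 0 < τ) (hja : a j = τ * z j) : ∃ k ∈ s, c k = τ * z k := by
  by_contra! hne
  -- With this `ε` every term of the `c`-sum is affine on `[τ - ε, τ + ε]`, while `ε ≤ τ` keeps the
  -- interval where `h` applies. The `a`-sum is convex and bends strictly at `τ` because of its term
  -- `j`.
  obtain ⟨ε, hε0, hετ, hε⟩ : ∃ ε, 0 < ε ∧ ε ≤ τ ∧ ∀ k ∈ s, ε * z k ≤ |τ * z k - c k| := by
    have hs : s.Nonempty := ⟨j, hj⟩
    refine ⟨min τ (s.inf' hs fun k => |τ * z k - c k| / z k), lt_min hτ ?_, min_le_left _ _,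
      fun k hk => ?_⟩
    · obtain ⟨k, hk, hk'⟩ := s.exists_mem_eq_inf' hs fun k => |τ * z k - c k| / z k
      rw [hk']
      exact div_pos (abs_pos.2 (sub_ne_zero.2 (hne k hk).symm)) (hz k hk)
    · rw [← le_div_iff₀ (hz k hk)]
      exact (min_le_right _ _).trans (Finset.inf'_le _ hk)
  have hlin : ∑ k ∈ s, |(τ + ε) * z k - c k| + ∑ k ∈ s, |(τ - ε) * z k - c k| =
      ∑ k ∈ s, |τ * z k - c k| + ∑ k ∈ s, |τ * z k - c k| := by
    rw [← Finset.sum_add_distrib, ← Finset.sum_add_distrib]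
    refine Finset.sum_congr rfl fun k hk => ?_
    have h1 := hε k hk
    have h2 : 0 < ε * z k := mul_pos hε0 (hz k hk)
    rcases abs_cases (τ * z k - c k) with h3 | h3 <;> rw [h3.1] at h1 ⊢
    · rw [abs_of_nonneg (by linarith), abs_of_nonneg (by linarith)]; ring
    · rw [abs_of_nonpos (by linarith), abs_of_nonpos (by linarith)]; ring
  have hlt : ∑ k ∈ s, |τ * z k - a k| + ∑ k ∈ s, |τ * z k - a k| <
      ∑ k ∈ s, |(τ + ε) * z k - a k| + ∑ k ∈ s, |(τ - ε) * z k - a k| := by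
    rw [← Finset.sum_add_distrib, ← Finset.sum_add_distrib]
    refine Finset.sum_lt_sum (fun k _ => ?_) ⟨j, hj, ?_⟩
    · have := abs_add_le ((τ + ε) * z k - a k) ((τ - ε) * z k - a k)
      rw [show (τ + ε) * z k - a k + ((τ - ε) * z k - a k) =
        (τ * z k - a k) + (τ * z k - a k) by ring, ← two_mul, abs_mul, abs_two, two_mul] at this
      exact this
    · rw [hja, sub_self, abs_zero, add_zero]
      refine add_pos_of_pos_of_nonneg (abs_pos.2 ?_) (abs_nonneg _)
      rw [add_mul, add_sub_cancel_left]
      exact (mul_pos hε0 (hz j hj)).ne'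
  rw [h (τ + ε) (by linarith), h (τ - ε) (by linarith), h τ hτ.le, hlin] at hlt
  exact lt_irrefl _ hlt

/-- A regular dominant vector avoiding finitely many hyperplanes. -/
lemma IsRootBasis.exists_regular_generic (hB : IsRootBasis P B) [P.IsRootSystem] {κ : Type*}
    [Finite κ] (φ : κ → Module.Dual F M) :
    ∃ z : M, (∀ i, IsPositive P B i → 0 < P.coroot' i z) ∧ ∀ k, φ k ≠ 0 → φ k z ≠ 0 := by
  classical
  obtain ⟨z₀, hz₀⟩ := hB.exists_regular
  obtain ⟨z₁, hz₁⟩ := Module.Dual.exists_forall_ne_zero_of_forall_exists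
    (fun k : {k // φ k ≠ 0} => φ k) (fun k => by
      by_contra! h
      exact k.2 (LinearMap.ext h))
  -- Far along `z₀` the sum is regular, and each functional, being nonzero at `z₁`, vanishes for at
  -- most one `n`.
  have hev : ∀ᶠ n : ℕ in Filter.atTop, (∀ i, IsPositive P B i → 0 < P.coroot' i (z₁ + n • z₀)) ∧
      ∀ k : {k // φ k ≠ 0}, φ k (z₁ + n • z₀) ≠ 0 := by
    refine Filter.Eventually.and ?_ ?_
    · rw [Filter.eventually_all]
      intro i
      by_cases hi : IsPositive P B i
      · obtain ⟨n, hn⟩ := exists_nat_gt (-(P.coroot' i z₁) / P.coroot' i z₀)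
        filter_upwards [Filter.eventually_ge_atTop n] with m hm _
        have h0 := hz₀ i hi
        rw [div_lt_iff₀ h0] at hn
        have h1 : (n : F) * P.coroot' i z₀ ≤ m * P.coroot' i z₀ :=
          mul_le_mul_of_nonneg_right (by exact_mod_cast hm) h0.le
        rw [map_add, map_nsmul, nsmul_eq_mul]
        linarith
      · exact Filter.Eventually.of_forall fun _ h => absurd h hi
    · rw [Filter.eventually_all]
      intro k
      by_cases h : ∃ n : ℕ, φ k (z₁ + n • z₀) = 0
      · obtain ⟨n, hn⟩ := h
        filter_upwards [Filter.eventually_gt_atTop n] with m hm hm0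
        rw [map_add, map_nsmul, nsmul_eq_mul] at hn hm0
        have h3 : ((m : F) - n) * φ k z₀ = 0 := by linear_combination hm0 - hn
        rcases mul_eq_zero.1 h3 with h4 | h4
        · rw [sub_eq_zero] at h4
          have : m = n := by exact_mod_cast h4
          omega
        · rw [h4, mul_zero, add_zero] at hn
          exact hz₁ k hn
      · exact Filter.Eventually.of_forall fun n hn => h ⟨n, hn⟩
  obtain ⟨n, hn1, hn2⟩ := hev.exists
  exact ⟨_, hn1, fun k hk => hn2 ⟨k, hk⟩⟩

/-- Along the ray of a dominant `z`, the norm of `τ z - a` has a kink at `τ = a_j / z_j`, so some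
`c_k / z_k` has the same value. For generic `z` this forces `a_j α_k^∨ = c_k α_j^∨` as functionals,
and evaluating at `c` gives `a_j = c_j`. -/
lemma IsRootBasis.coroot'_eq_of_rootNorm_eq (hB : IsRootBasis P B) [P.IsRootSystem] {a c : M}
    (h : ∀ x, IsDominant P B x → rootNorm P B (x - a) = rootNorm P B (x - c)) {j : ι}
    (hj : IsPositive P B j) (ha : 0 < P.coroot' j a) : P.coroot' j c = P.coroot' j a := by
  classical
  obtain ⟨z, hz, hgen⟩ := hB.exists_regular_generic
    (fun k : ι => (P.coroot' j a) • P.coroot' k - (P.coroot' k c) • P.coroot' j)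
  have hzj := hz j hj
  obtain ⟨k, hk, hkc⟩ := exists_eq_mul_of_sum_abs_eq {i | IsPositive P B i}
    (fun i => P.coroot' i z) (fun i => P.coroot' i a) (fun i => P.coroot' i c)
    (fun i hi => hz i (Finset.mem_filter.1 hi).2) (fun τ hτ => by
      have := h (τ • z) (fun i hi => by
        rw [map_smul]
        exact mul_nonneg hτ (hz i hi).le)
      simpa only [rootNorm, map_sub, map_smul, smul_eq_mul] using this)
    (j := j) (by simpa using hj) (τ := P.coroot' j a / P.coroot' j z) (div_pos ha hzj)
    (by field_simp)
  have hzk := hz k (Finset.mem_filter.1 hk).2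
  have h0 : (P.coroot' j a) • P.coroot' k - (P.coroot' k c) • P.coroot' j = 0 := by
    by_contra hne
    refine hgen k hne ?_
    rw [LinearMap.sub_apply, LinearMap.smul_apply, LinearMap.smul_apply, hkc]
    simp only [smul_eq_mul]
    field_simp
    ring
  have h1 := LinearMap.congr_fun h0 c
  rw [LinearMap.sub_apply, LinearMap.smul_apply, LinearMap.smul_apply, LinearMap.zero_apply,
    smul_eq_mul, smul_eq_mul, mul_comm, ← mul_sub] at h1
  rcases mul_eq_zero.1 h1 with h2 | h2
  · rw [h2] at hkc
    exact absurd hkc.symm (mul_pos (div_pos ha hzj) hzk).ne'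
  · linarith

omit [Fintype ι] in
lemma Weyl.coroot'_refl (i j : ι) (x : M) :
    P.coroot' j ((Weyl.refl P i).1 x) = P.coroot' (P.reflectionPerm i j) x :=
  P.coroot'_reflection x

/-- If no simple coroot is positive at `a`, then `-a` and `-w a` are dominant in one orbit, hence
equal. Otherwise reflect in a simple root positive at `a` and conjugate `w`. The values at multiples
of `b` turn negative for both points and the others are permuted, so the number of positive values
drops. -/
lemma IsRootBasis.apply_eq_of_posPart_eq (hB : IsRootBasis P B) [P.IsRootSystem] {a : M}
    {w : Weyl P} (h : ∀ j, IsPositive P B j → 0 < P.coroot' j a ∨ 0 < P.coroot' j (w.1 a) →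
      P.coroot' j (w.1 a) = P.coroot' j a) : w.1 a = a := by
  classical
  induction hn : Finset.card {j | IsPositive P B j ∧ 0 < P.coroot' j a} using
    Nat.strong_induction_on generalizing a w with
  | _ n ih =>
    by_cases hex : ∃ b : B, 0 < P.coroot' b a
    · obtain ⟨b, hb⟩ := hex
      set s := Weyl.refl P b with hs
      have hss : ∀ x, s.1 (s.1 x) = x := fun x => by
        change P.reflection b (P.reflection b x) = x
        simp
      have hw : (s * w * s).1 (s.1 a) = s.1 (w.1 a) := by
        change s.1 (w.1 (s.1 (s.1 a))) = s.1 (w.1 a)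
        rw [hss]
      have hpar : ∀ j, IsPositive P B j → IsParallel P b j → 0 < P.coroot' j a := by
        intro j hj hpar
        obtain ⟨c, hc0, hc⟩ := hB.coroot_parallel hj hpar
        rw [RootPairing.coroot', hc, map_smul, LinearMap.smul_apply]
        exact mul_pos hc0 hb
      have hneg : ∀ j, IsPositive P B j → IsParallel P b j →
          P.coroot' j (s.1 a) < 0 ∧ P.coroot' j (s.1 (w.1 a)) < 0 := by
        intro j hj hp
        have h1 := hpar j hj hp
        have h2 := h j hj (Or.inl h1)
        rw [hs, Weyl.coroot'_refl, Weyl.coroot'_refl, hp.reflectionPerm_eq, coroot'_neg_index,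
          coroot'_neg_index, h2]
        exact ⟨neg_neg_of_pos h1, neg_neg_of_pos h1⟩
      have hinj : Function.Injective (P.reflectionPerm b) := Equiv.injective _
      have hlt : Finset.card {j | IsPositive P B j ∧ 0 < P.coroot' j (s.1 a)} < n := by
        rw [← hn, ← Finset.card_image_of_injective _ hinj]
        refine Finset.card_lt_card ⟨fun j hj => ?_, fun hsub => ?_⟩
        · obtain ⟨k, hk, rfl⟩ := Finset.mem_image.1 hj
          simp only [Finset.mem_filter, Finset.mem_univ, true_and] at hk ⊢
          have hp : ¬ IsParallel P b k := fun hp => lt_asymm hk.2 (hneg k hk.1 hp).1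
          exact ⟨hB.isPositive_reflectionPerm hk.1 hp, by
            rw [← Weyl.coroot'_refl]; exact hk.2⟩
        · have hb' := hsub (Finset.mem_filter.2 ⟨Finset.mem_univ (b : ι),
            IsRootBasis.isPositive_of_mem b.2, hb⟩)
          obtain ⟨k, hk, hkb⟩ := Finset.mem_image.1 hb'
          simp only [Finset.mem_filter, Finset.mem_univ, true_and] at hk
          have hp : IsParallel P b k := by
            rw [← IsParallel.reflectionPerm, hkb]
            exact isParallel_self _
          exact lt_asymm hk.2 (hneg k hk.1 hp).1
      have key := ih _ hlt (a := s.1 a) (w := s * w * s) (fun j hj hor => by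
        rw [hw] at hor ⊢
        have hp : ¬ IsParallel P b j := fun hp => by
          rcases hor with hor | hor
          · exact lt_asymm hor (hneg j hj hp).1
          · exact lt_asymm hor (hneg j hj hp).2
        rw [hs, Weyl.coroot'_refl, Weyl.coroot'_refl] at hor ⊢
        exact h _ (hB.isPositive_reflectionPerm hj hp) hor) rfl
      rw [hw] at key
      exact s.1.injective key
    · push Not at hex
      have h1 : IsDominant P B (-a) := fun i hi =>
        hB.coroot'_nonneg (fun b hb => by
          rw [map_neg]
          exact neg_nonneg.2 (hex ⟨b, hb⟩)) hi
      have h2 : IsDominant P B (w.1 (-a)) := fun i hi => by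
        have h3 := h1 i hi
        rw [map_neg] at h3
        rw [map_neg, map_neg]
        by_contra hlt
        have h4 : 0 < P.coroot' i (w.1 a) := by linarith
        have h5 := h i hi (Or.inr h4)
        linarith
      have h3 := h1.apply_eq hB h2
      rwa [map_neg, neg_inj] at h3

/-- The distances to the points of the fundamental chamber separate the points of an orbit of the
Weyl group. -/
lemma IsRootBasis.apply_eq_of_rootNorm_eq (hB : IsRootBasis P B) [P.IsRootSystem] {a : M}
    {w : Weyl P}
    (h : ∀ x, IsDominant P B x → rootNorm P B (x - a) = rootNorm P B (x - w.1 a)) :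
    w.1 a = a := by
  refine hB.apply_eq_of_posPart_eq fun j hj hor => ?_
  rcases hor with hor | hor
  · exact hB.coroot'_eq_of_rootNorm_eq h hj hor
  · exact (hB.coroot'_eq_of_rootNorm_eq (fun x hx => (h x hx).symm) hj hor).symm

end WeylGeometry

section Model

variable {F : Subfield ℝ} {ι M N : Type*} [AddCommGroup M] [Module F M]
  [AddCommGroup N] [Module F N] {P : RootPairing ι F M N} {B : Set ι}
  {Λ : Type*} [AddCommGroup Λ] [Module F Λ]

/-! ### The action of the Weyl group on the model space -/

/-- The action of the Weyl group on the model space. -/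
def Weyl.act (w : Weyl P) : ModelSpace Λ P ≃ₗ[F] ModelSpace Λ P := LinearEquiv.rTensor Λ w.1

lemma Weyl.act_mul (v w : Weyl P) (x : ModelSpace Λ P) : (v * w).act x = v.act (w.act x) := by
  simp only [act]
  rw [Subgroup.coe_mul, LinearEquiv.rTensor_mul]
  rfl

lemma Weyl.act_one (x : ModelSpace Λ P) : (1 : Weyl P).act x = x := by
  induction x using TensorProduct.induction_on with
  | zero => simp
  | add x y hx hy => rw [map_add, hx, hy]
  | tmul m l => rfl

lemma Weyl.act_tmul (w : Weyl P) (m : M) (l : Λ) : w.act (m ⊗ₜ[F] l) = w.1 m ⊗ₜ l := rfl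

lemma Weyl.act_inv_act (w : Weyl P) (x : ModelSpace Λ P) : w⁻¹.act (w.act x) = x := by
  rw [← act_mul, inv_mul_cancel, act_one]

lemma Weyl.act_act_inv (w : Weyl P) (x : ModelSpace Λ P) : w.act (w⁻¹.act x) = x := by
  rw [← act_mul, mul_inv_cancel, act_one]

lemma Weyl.act_refl_refl (i : ι) (x : ModelSpace Λ P) :
    (Weyl.refl P i).act ((Weyl.refl P i).act x) = x := by
  rw [← act_mul, refl_mul_self, act_one]

lemma Weyl.comp_act_comp_act {X : Type*} (f : ModelSpace Λ P → X) (v w : Weyl P) :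
    (f ∘ v.act) ∘ w.act = f ∘ (v * w).act :=
  funext fun x => congrArg f (v.act_mul w x).symm

lemma Weyl.comp_act_one {X : Type*} (f : ModelSpace Λ P → X) : f ∘ (1 : Weyl P).act = f :=
  funext fun x => congrArg f (Weyl.act_one x)

lemma Weyl.range_comp_act {X : Type*} (f : ModelSpace Λ P → X) (w : Weyl P) :
    Set.range (f ∘ w.act) = Set.range f :=
  w.act.surjective.range_comp f

lemma coeval_tmul (i : ι) (m : M) (l : Λ) : coeval P i (m ⊗ₜ[F] l) = P.coroot' i m • l := by
  simp [coeval]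

lemma Weyl.coeval_perm_act (w : Weyl P) (i : ι) (x : ModelSpace Λ P) :
    coeval P (w.perm i) (w.act x) = coeval P i x := by
  induction x using TensorProduct.induction_on with
  | zero => simp
  | add x y hx hy => rw [map_add, map_add, map_add, hx, hy]
  | tmul m l => rw [act_tmul, coeval_tmul, coeval_tmul, w.coroot'_perm]

lemma Weyl.coeval_act (w : Weyl P) (i : ι) (x : ModelSpace Λ P) :
    coeval P i (w.act x) = coeval P (w⁻¹.perm i) x := by
  rw [← w.coeval_perm_act (w⁻¹.perm i), w.perm_perm_inv]

lemma Weyl.act_refl_apply (i : ι) (x : ModelSpace Λ P) :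
    (Weyl.refl P i).act x = x - P.root i ⊗ₜ[F] coeval P i x := by
  induction x using TensorProduct.induction_on with
  | zero => simp
  | add x y hx hy => rw [map_add, map_add, hx, hy, TensorProduct.tmul_add]; abel
  | tmul m l =>
    rw [act_tmul, refl_apply, P.reflection_apply, coeval_tmul, TensorProduct.sub_tmul,
      TensorProduct.smul_tmul]

lemma mem_sphericalWeylGroup_iff {g : ModelSpace Λ P ≃ₗ[F] ModelSpace Λ P} :
    g ∈ sphericalWeylGroup Λ P ↔ ∃ w : Weyl P, g = w.act := by
  constructor
  · intro hg
    induction hg using Subgroup.closure_induction with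
    | mem g hg =>
      obtain ⟨i, rfl⟩ := hg
      exact ⟨Weyl.refl P i, rfl⟩
    | one => exact ⟨1, LinearEquiv.ext fun x => (Weyl.act_one x).symm⟩
    | mul a b _ _ ha hb =>
      obtain ⟨v, rfl⟩ := ha
      obtain ⟨w, rfl⟩ := hb
      exact ⟨v * w, LinearEquiv.ext fun x => (Weyl.act_mul v w x).symm⟩
    | inv a _ ha =>
      obtain ⟨v, rfl⟩ := ha
      refine ⟨v⁻¹, LinearEquiv.ext fun x => ?_⟩
      exact (LinearEquiv.symm_apply_eq _).2 (v.act_act_inv x).symm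
  · rintro ⟨⟨w, hw⟩, rfl⟩
    induction hw using Subgroup.closure_induction with
    | mem w hw =>
      obtain ⟨i, rfl⟩ := hw
      exact Subgroup.subset_closure ⟨i, rfl⟩
    | one =>
      rw [show Weyl.act ⟨1, _⟩ = (1 : ModelSpace Λ P ≃ₗ[F] ModelSpace Λ P) from
        LinearEquiv.ext fun x => Weyl.act_one x]
      exact one_mem _
    | mul a b ha' hb' ha hb =>
      rw [show Weyl.act ⟨a * b, _⟩ = (Weyl.act ⟨a, ha'⟩ : ModelSpace Λ P ≃ₗ[F] ModelSpace Λ P) *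
        Weyl.act ⟨b, hb'⟩ from LinearEquiv.ext fun x => Weyl.act_mul ⟨a, ha'⟩ ⟨b, hb'⟩ x]
      exact mul_mem ha hb
    | inv a ha' ha =>
      rw [show Weyl.act ⟨a⁻¹, _⟩ = (Weyl.act ⟨a, ha'⟩ : ModelSpace Λ P ≃ₗ[F] ModelSpace Λ P)⁻¹ from
        LinearEquiv.ext fun x => ((LinearEquiv.symm_apply_eq _).2
          (Weyl.act_act_inv ⟨a, ha'⟩ x).symm).symm]
      exact inv_mem ha

lemma mem_affineWeylGroup_iff {T : AddSubgroup (ModelSpace Λ P)}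
    {g : ModelSpace Λ P → ModelSpace Λ P} :
    g ∈ affineWeylGroup P T ↔ ∃ w : Weyl P, ∃ t ∈ T, ∀ x, g x = w.act x + t := by
  constructor
  · rintro ⟨w, hw, t, ht, h⟩
    obtain ⟨v, rfl⟩ := mem_sphericalWeylGroup_iff.1 hw
    exact ⟨v, t, ht, h⟩
  · rintro ⟨w, t, ht, h⟩
    exact ⟨w.act, mem_sphericalWeylGroup_iff.2 ⟨w, rfl⟩, t, ht, h⟩

lemma IsTranslationGroup.act_mem {T : AddSubgroup (ModelSpace Λ P)} (hT : IsTranslationGroup P T)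
    (w : Weyl P) {t : ModelSpace Λ P} (ht : t ∈ T) : w.act t ∈ T :=
  hT.weyl_mem _ (mem_sphericalWeylGroup_iff.2 ⟨w, rfl⟩) t ht

lemma IsTranslationGroup.nontrivial {T : AddSubgroup (ModelSpace Λ P)}
    (hT : IsTranslationGroup P T) : Nontrivial Λ := by
  by_contra h
  rw [not_nontrivial_iff_subsingleton] at h
  refine hT.ne_bot ?_
  have : Subsingleton (ModelSpace Λ P) := by
    refine ⟨fun x y => ?_⟩
    have h0 : ∀ x : ModelSpace Λ P, x = 0 := fun x => by
      induction x using TensorProduct.induction_on with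
      | zero => rfl
      | add x y hx hy => rw [hx, hy, add_zero]
      | tmul m l => rw [Subsingleton.elim l 0, TensorProduct.tmul_zero]
    rw [h0 x, h0 y]
  exact Subsingleton.elim _ _

variable [Fintype ι]

lemma IsRootBasis.coeval_parallel (hB : IsRootBasis P B) [P.IsRootSystem] {j : ι}
    (hj : IsPositive P B j) {b : B} (h : IsParallel P b j) :
    ∃ c : F, 0 < c ∧ ∀ x : ModelSpace Λ P, coeval P j x = c • coeval P b x := by
  obtain ⟨c, hc0, hc⟩ := hB.coroot_parallel hj h
  refine ⟨c, hc0, fun x => ?_⟩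
  induction x using TensorProduct.induction_on with
  | zero => simp
  | add x y hx hy => rw [map_add, map_add, smul_add, hx, hy]
  | tmul m l =>
    rw [coeval_tmul, coeval_tmul, RootPairing.coroot', hc, map_smul, LinearMap.smul_apply,
      smul_assoc]

variable [LinearOrder Λ] [IsOrderedAddMonoid Λ] [IsOrderedModule F Λ]

/-! ### Cones -/

/-- The translate of the fundamental chamber with apex `p`. -/
def cone (B : Set ι) (p : ModelSpace Λ P) : Set (ModelSpace Λ P) :=
  {x | ∀ i, IsPositive P B i → coeval P i p ≤ coeval P i x}

lemma IsRootBasis.exists_coeval_ge (hB : IsRootBasis P B) [P.IsRootSystem] (μ : ι → Λ) :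
    ∃ x : ModelSpace Λ P, ∀ i, IsPositive P B i → μ i ≤ coeval P i x := by
  classical
  obtain ⟨z, hz⟩ := hB.exists_regular
  -- As `Λ` need not be archimedean, multiples of a fixed element may never be large enough; the
  -- tensor factor is built from the bounds themselves.
  refine ⟨z ⊗ₜ ∑ i with IsPositive P B i, (P.coroot' i z)⁻¹ • |μ i|, fun i hi => ?_⟩
  rw [coeval_tmul]
  have h1 : (P.coroot' i z)⁻¹ • |μ i| ≤ ∑ i with IsPositive P B i, (P.coroot' i z)⁻¹ • |μ i| :=
    Finset.single_le_sum (f := fun i => (P.coroot' i z)⁻¹ • |μ i|)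
      (fun j hj => smul_nonneg (inv_nonneg.2 (hz j (Finset.mem_filter.1 hj).2).le) (abs_nonneg _))
      (Finset.mem_filter.2 ⟨Finset.mem_univ _, hi⟩)
  have h2 := smul_le_smul_of_nonneg_left h1 (hz i hi).le
  rw [smul_inv_smul₀ (hz i hi).ne'] at h2
  exact (le_abs_self _).trans h2

lemma IsRootBasis.exists_cone_subset (hB : IsRootBasis P B) [P.IsRootSystem]
    (p q : ModelSpace Λ P) : ∃ r, cone B r ⊆ cone B p ∩ cone B q := by
  obtain ⟨r, hr⟩ := hB.exists_coeval_ge (fun i => max (coeval P i p) (coeval P i q))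
  exact ⟨r, fun x hx => ⟨fun i hi => ((le_max_left _ _).trans (hr i hi)).trans (hx i hi),
    fun i hi => ((le_max_right _ _).trans (hr i hi)).trans (hx i hi)⟩⟩

lemma IsRootBasis.coeval_nonneg (hB : IsRootBasis P B) [P.IsRootSystem] {x : ModelSpace Λ P}
    (hx : ∀ b ∈ B, 0 ≤ coeval P b x) {i : ι} (hi : IsPositive P B i) : 0 ≤ coeval P i x := by
  classical
  have h : coeval (Λ := Λ) P i = ∑ b : B, hB.corootCoeff i b • coeval P b := by
    ext m l
    simp only [TensorProduct.AlgebraTensorModule.curry_apply, TensorProduct.curry_apply,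
      LinearMap.coe_restrictScalars, LinearMap.sum_apply, LinearMap.smul_apply, coeval_tmul]
    rw [hB.coroot'_eq_sum i, LinearMap.sum_apply, Finset.sum_smul]
    simp only [LinearMap.smul_apply, smul_eq_mul, mul_smul]
  rw [h, LinearMap.sum_apply]
  exact Finset.sum_nonneg fun b _ => smul_nonneg (hB.corootCoeff_nonneg hi b) (hx b b.2)

/-- Every vector of the model space is conjugate to one in the fundamental chamber. -/
lemma IsRootBasis.exists_act_nonneg (hB : IsRootBasis P B) [P.IsRootSystem] (x : ModelSpace Λ P) :
    ∃ w : Weyl P, ∀ i, IsPositive P B i → 0 ≤ coeval P i (w.act x) := by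
  classical
  induction hn : Finset.card {j | IsPositive P B j ∧ coeval P j x < 0} using
    Nat.strong_induction_on generalizing x with
  | _ n ih =>
    by_cases hex : ∃ b : B, coeval P b x < 0
    · obtain ⟨b, hb⟩ := hex
      set s := Weyl.refl P b with hs
      have hco : ∀ j, coeval P j (s.act x) = coeval P (P.reflectionPerm b j) x :=
        fun j => coeval_reflection P b j x
      have hneg : ∀ j, IsPositive P B j → IsParallel P b j → 0 ≤ coeval P j (s.act x) := by
        intro j hj hp
        obtain ⟨c, hc0, hc⟩ := hB.coeval_parallel (Λ := Λ) hj hp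
        rw [hco, hp.reflectionPerm_eq, coeval_neg_index, hc, ← smul_neg]
        exact smul_nonneg hc0.le (neg_nonneg.2 hb.le)
      have hinj : Function.Injective (P.reflectionPerm b) := Equiv.injective _
      have hlt : Finset.card {j | IsPositive P B j ∧ coeval P j (s.act x) < 0} < n := by
        rw [← hn, ← Finset.card_image_of_injective _ hinj]
        refine Finset.card_lt_card ⟨fun j hj => ?_, fun hsub => ?_⟩
        · obtain ⟨k, hk, rfl⟩ := Finset.mem_image.1 hj
          simp only [Finset.mem_filter, Finset.mem_univ, true_and] at hk ⊢
          have hp : ¬ IsParallel P b k := fun hp => (hneg k hk.1 hp).not_gt hk.2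
          exact ⟨hB.isPositive_reflectionPerm hk.1 hp, by rw [← hco]; exact hk.2⟩
        · have hb' := hsub (Finset.mem_filter.2 ⟨Finset.mem_univ (b : ι),
            IsRootBasis.isPositive_of_mem b.2, hb⟩)
          obtain ⟨k, hk, hkb⟩ := Finset.mem_image.1 hb'
          simp only [Finset.mem_filter, Finset.mem_univ, true_and] at hk
          have hp : IsParallel P b k := by
            rw [← IsParallel.reflectionPerm, hkb]
            exact isParallel_self _
          exact (hneg k hk.1 hp).not_gt hk.2
      obtain ⟨w, hw⟩ := ih _ hlt (s.act x) rfl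
      exact ⟨w * s, fun i hi => by rw [Weyl.act_mul]; exact hw i hi⟩
    · push Not at hex
      exact ⟨1, fun i hi => by
        rw [Weyl.act_one]
        exact hB.coeval_nonneg (fun b hb => hex ⟨b, hb⟩) hi⟩

variable [Nontrivial Λ]

/-- All positive roots become arbitrarily large on a cone, so a root that is negative there has no
lower bound. Applied to the half-apartments cutting out a convex set that contains a cone. -/
lemma IsRootBasis.isPositive_of_bddBelow (hB : IsRootBasis P B) [P.IsRootSystem] {i : ι}
    {w : Weyl P} {p : ModelSpace Λ P} {μ : Λ} (h : ∀ x ∈ cone B p, μ ≤ coeval P i (w.act x)) :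
    IsPositive P B (w⁻¹.perm i) := by
  by_contra hneg
  rw [← hB.isPositive_neg_iff] at hneg
  obtain ⟨l, hl⟩ := exists_zero_lt (α := Λ)
  obtain ⟨x, hx⟩ := hB.exists_coeval_ge (fun j => max (coeval P j p) (l - μ))
  have h1 := h x fun j hj => (le_max_left _ _).trans (hx j hj)
  have h2 := (le_max_right _ _).trans (hx _ hneg)
  rw [coeval_neg_index, ← w.coeval_act] at h2
  have h3 := add_le_add h1 h2
  rw [add_neg_cancel, add_sub_cancel] at h3
  exact h3.not_gt hl

lemma IsRootBasis.eq_one_of_act_cone_subset (hB : IsRootBasis P B) [P.IsRootSystem] {w : Weyl P}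
    {p q t : ModelSpace Λ P} (h : ∀ x ∈ cone B p, w.act x + t ∈ cone B q) : w = 1 := by
  rw [← inv_eq_one]
  refine hB.eq_one_of_isPositive_perm fun b hb => ?_
  refine hB.isPositive_of_bddBelow (p := p) (μ := coeval P b q - coeval P b t) fun x hx => ?_
  have := h x hx b (IsRootBasis.isPositive_of_mem hb)
  rw [map_add] at this
  exact sub_le_iff_le_add.2 this

/-- Composing one linear part with the inverse of the other maps a cone into a translate of itself,
which preserves the positivity of simple roots. -/
lemma IsRootBasis.eq_of_act_add_eq (hB : IsRootBasis P B) [P.IsRootSystem] {v w : Weyl P}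
    {p t t' : ModelSpace Λ P} (h : ∀ x ∈ cone B p, v.act x + t = w.act x + t') :
    v = w ∧ t = t' := by
  have hvw : w⁻¹ * v = 1 := by
    obtain ⟨q, hq⟩ : ∃ q, q = p + (w⁻¹.act t' - w⁻¹.act t) := ⟨_, rfl⟩
    refine hB.eq_one_of_act_cone_subset (p := p) (q := q) (t := 0) fun x hx i hi => ?_
    have h1 : v.act x = w.act x + t' - t := by rw [← h x hx, add_sub_cancel_right]
    rw [hq, add_zero, Weyl.act_mul, h1, map_sub, map_add w⁻¹.act, Weyl.act_inv_act, add_sub_assoc,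
      map_add, map_add]
    exact add_le_add_left (hx i hi) _
  have hvw' : v = w := by rw [← mul_one w, ← hvw, mul_inv_cancel_left]
  refine ⟨hvw', ?_⟩
  have := h p fun i _ => le_rfl
  rw [hvw'] at this
  exact add_left_cancel this

/-! ### Convex sets containing cones -/

/-- The second cone points to the chamber adjacent to the opposite of `C` across type `b`. A root
bounded below on both cones is positive and stays positive under `w s_b`, so it is a multiple of
`b`. The constraints are then nested, and the strongest one remains. -/
lemma IsRootBasis.eq_univ_or_halfApartment (hB : IsRootBasis P B) [P.IsRootSystem] {w : Weyl P}
    (hw : IsLongest B w) (b : B) {Y : Set (ModelSpace Λ P)} (hY : IsConvex P Y)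
    {p q : ModelSpace Λ P} (hp : ∀ x ∈ cone B p, x ∈ Y)
    (hq : ∀ x ∈ cone B q, (Weyl.refl P b * w).act x ∈ Y) :
    Y = Set.univ ∨ ∃ e, Y = halfApartment P b e := by
  classical
  obtain ⟨s, rfl⟩ := hY
  have hs : ∀ a ∈ s, ∃ ν, halfApartment P a.1 a.2 = halfApartment P b ν := by
    intro a ha
    have h1 : IsPositive P B a.1 := by
      have := hB.isPositive_of_bddBelow (i := a.1) (w := 1) (p := p) (μ := a.2) fun x hx => by
        rw [Weyl.act_one]
        exact Set.mem_iInter₂.1 (hp x hx) a ha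
      rwa [inv_one, Weyl.perm_one_apply] at this
    have h2 := hB.isPositive_of_bddBelow (i := a.1) (p := q) (μ := a.2) fun x hx =>
      Set.mem_iInter₂.1 (hq x hx) a ha
    rw [mul_inv_rev, Weyl.refl_inv, inv_eq_of_mul_eq_one_right (hw.mul_self hB),
      Weyl.perm_mul_apply, Weyl.perm_refl_apply] at h2
    have hpar : IsParallel P b a.1 := by
      by_contra hpar
      exact hw _ (hB.isPositive_reflectionPerm h1 hpar) h2
    obtain ⟨c, hc0, hc⟩ := hB.coeval_parallel (Λ := Λ) h1 hpar
    refine ⟨c⁻¹ • a.2, Set.ext fun x => ?_⟩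
    change a.2 ≤ coeval P a.1 x ↔ c⁻¹ • a.2 ≤ coeval P b x
    rw [hc, inv_smul_le_iff_of_pos hc0]
  choose! ν hν using hs
  rcases s.eq_empty_or_nonempty with rfl | hne
  · left
    simp
  · right
    refine ⟨s.sup' hne ν, Set.ext fun x => ?_⟩
    rw [Set.mem_iInter₂]
    change _ ↔ s.sup' hne ν ≤ coeval P b x
    rw [Finset.sup'_le_iff]
    refine forall₂_congr fun a ha => ?_
    rw [hν a ha]
    rfl

lemma IsRootBasis.eq_univ_of_opposite (hB : IsRootBasis P B) [P.IsRootSystem] {w : Weyl P}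
    (hw : IsLongest B w) {Y : Set (ModelSpace Λ P)} (hY : IsConvex P Y)
    {p q : ModelSpace Λ P} (hp : ∀ x ∈ cone B p, x ∈ Y) (hq : ∀ x ∈ cone B q, w.act x ∈ Y) :
    Y = Set.univ := by
  obtain ⟨s, rfl⟩ := hY
  rcases s.eq_empty_or_nonempty with rfl | ⟨a, ha⟩
  · simp
  · have h1 : IsPositive P B a.1 := by
      have := hB.isPositive_of_bddBelow (i := a.1) (w := 1) (p := p) (μ := a.2) fun x hx => by
        rw [Weyl.act_one]
        exact Set.mem_iInter₂.1 (hp x hx) a ha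
      rwa [inv_one, Weyl.perm_one_apply] at this
    have h2 := hB.isPositive_of_bddBelow (i := a.1) (p := q) (μ := a.2) fun x hx =>
      Set.mem_iInter₂.1 (hq x hx) a ha
    rw [inv_eq_of_mul_eq_one_right (hw.mul_self hB)] at h2
    exact absurd h2 (hw _ h1)

end Model

/-! ### The distance of the model space -/

section Norm

variable {F : Subfield ℝ} {ι M N : Type*} [AddCommGroup M] [Module F M]
  [AddCommGroup N] [Module F N] {P : RootPairing ι F M N} {B : Set ι}
  {Λ : Type*} [AddCommGroup Λ] [Module F Λ] [LinearOrder Λ] [IsOrderedAddMonoid Λ] [Fintype ι]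

omit [IsOrderedAddMonoid Λ] in
lemma modelDist_comm (x y : ModelSpace Λ P) : modelDist P B x y = modelDist P B y x := by
  unfold modelDist
  refine Finset.sum_congr rfl fun i _ => ?_
  rw [← abs_neg, ← map_neg, neg_sub]

lemma modelDist_triangle (x y z : ModelSpace Λ P) :
    modelDist P B x z ≤ modelDist P B x y + modelDist P B y z := by
  unfold modelDist
  rw [← Finset.sum_add_distrib]
  refine Finset.sum_le_sum fun i _ => ?_
  rw [← sub_add_sub_cancel' y x z, map_add]
  exact abs_add_le _ _

omit [IsOrderedAddMonoid Λ] in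
lemma modelDist_add_right (x y z : ModelSpace Λ P) :
    modelDist P B (x + z) (y + z) = modelDist P B x y := by
  unfold modelDist
  rw [add_sub_add_right_eq_sub]

open Classical in
/-- The functional `∑_{α ∈ R⁺} α^∨` on the model space. -/
def coevalSum (B : Set ι) : ModelSpace Λ P →ₗ[F] Λ := ∑ i with IsPositive P B i, coeval P i

/-- Every absolute value opens with the same sign, so the distance is linear here. All distance
computations with far points rest on this. -/
lemma modelDist_eq_coevalSum {x y : ModelSpace Λ P}
    (h : ∀ i, IsPositive P B i → coeval P i x ≤ coeval P i y) :
    modelDist P B x y = coevalSum B y - coevalSum B x := by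
  classical
  rw [← map_sub, coevalSum, LinearMap.sum_apply, modelDist]
  refine Finset.sum_congr rfl fun i hi => abs_of_nonneg ?_
  rw [map_sub]
  exact sub_nonneg.2 (h i (Finset.mem_filter.1 hi).2)

omit [LinearOrder Λ] [IsOrderedAddMonoid Λ] in
lemma coevalSum_tmul (m : M) (l : Λ) :
    coevalSum B (P := P) (m ⊗ₜ[F] l) = corootSum P B m • l := by
  rw [coevalSum, corootSum, LinearMap.sum_apply, Finset.sum_smul]
  simp only [coeval_tmul]

lemma modelDist_tmul [IsOrderedModule F Λ] (x y : M) {l : Λ} (hl : 0 ≤ l) :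
    modelDist P B (y ⊗ₜ[F] l) (x ⊗ₜ[F] l) = rootNorm P B (x - y) • l := by
  rw [modelDist, rootNorm, Finset.sum_smul]
  refine Finset.sum_congr rfl fun i _ => ?_
  rw [← TensorProduct.sub_tmul, coeval_tmul, abs_smul, abs_of_nonneg hl]

/-- Taking `l` larger than `K / (a - c)` absorbs a bounded error. This turns distances between rays
in `Λ` into inequalities in `F`. -/
lemma le_of_forall_smul_le [IsOrderedModule F Λ] [Nontrivial Λ] {a c : F} {K : Λ}
    (h : ∀ l : Λ, 0 ≤ l → a • l ≤ c • l + K) : a ≤ c := by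
  by_contra! hlt
  obtain ⟨l₀, hl₀⟩ := exists_zero_lt (α := Λ)
  have hac : 0 < a - c := sub_pos.2 hlt
  have h1 := h ((a - c)⁻¹ • (|K| + l₀))
    (smul_nonneg (inv_nonneg.2 hac.le) (add_nonneg (abs_nonneg _) hl₀.le))
  rw [← sub_le_iff_le_add', ← sub_smul, smul_inv_smul₀ hac.ne'] at h1
  have h2 : |K| < |K| + l₀ := lt_add_of_pos_right _ hl₀
  exact (h2.trans_le h1).not_ge (le_abs_self K)

end Norm

/-! ### The spherical building at infinity -/

section Building

variable {F : Subfield ℝ} {ι M N : Type*} [AddCommGroup M] [Module F M]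
  [AddCommGroup N] [Module F N] {P : RootPairing ι F M N} {B : Set ι}
  {Λ : Type*} [AddCommGroup Λ] [Module F Λ] [LinearOrder Λ] [IsOrderedAddMonoid Λ]
  [IsOrderedModule F Λ] [Fintype ι] {X : Type*} {T : AddSubgroup (ModelSpace Λ P)}
  {𝒜 : Set (ModelSpace Λ P → X)}

/-! ### The metric of a building -/

omit [IsOrderedModule F Λ] in
lemma IsAffineBuilding.atlasDist_comm (hX : IsAffineBuilding P B T 𝒜) (hB : IsRootBasis P B)
    (x y : X) : atlasDist P B 𝒜 x y = atlasDist P B 𝒜 y x := by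
  obtain ⟨f, hf, ⟨p, rfl⟩, ⟨q, rfl⟩⟩ := hX.common_apartment x y
  rw [hX.atlasDist_eq hB hf, hX.atlasDist_eq hB hf, modelDist_comm]

omit [IsOrderedModule F Λ] in
-- The retraction onto an apartment through `x` and `z` fixes both and does not increase their
-- distances to `y`, which reduces the claim to the model space.
lemma IsAffineBuilding.atlasDist_triangle (hX : IsAffineBuilding P B T 𝒜) (hB : IsRootBasis P B)
    (x y z : X) : atlasDist P B 𝒜 x z ≤ atlasDist P B 𝒜 x y + atlasDist P B 𝒜 y z := by
  obtain ⟨f, hf, ⟨p, rfl⟩, ⟨q, rfl⟩⟩ := hX.common_apartment x z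
  obtain ⟨r, hr, hrf, hrd, -⟩ := hX.retraction f hf (f p) ⟨p, rfl⟩
  obtain ⟨m, hm⟩ := hr y
  have h1 := hrd (f p) y
  have h2 := hrd y (f q)
  rw [hrf _ ⟨p, rfl⟩, ← hm, hX.atlasDist_eq hB hf] at h1
  rw [hrf _ ⟨q, rfl⟩, ← hm, hX.atlasDist_eq hB hf] at h2
  rw [hX.atlasDist_eq hB hf]
  exact (modelDist_triangle p m q).trans (add_le_add h1 h2)

/-! ### Charts -/

omit [IsOrderedAddMonoid Λ] [IsOrderedModule F Λ] in
lemma IsAffineBuilding.comp_act_mem (hX : IsAffineBuilding P B T 𝒜) {f : ModelSpace Λ P → X}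
    (hf : f ∈ 𝒜) (w : Weyl P) : f ∘ w.act ∈ 𝒜 :=
  hX.comp_mem f hf w.act (mem_affineWeylGroup_iff.2
    ⟨w, 0, T.zero_mem, fun x => (add_zero _).symm⟩)

omit [IsOrderedAddMonoid Λ] [IsOrderedModule F Λ] in
lemma IsAffineBuilding.comp_add_mem (hX : IsAffineBuilding P B T 𝒜) {f : ModelSpace Λ P → X}
    (hf : f ∈ 𝒜) {t : ModelSpace Λ P} (ht : t ∈ T) : (fun x => f (x + t)) ∈ 𝒜 :=
  hX.comp_mem f hf (· + t) (mem_affineWeylGroup_iff.2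
    ⟨1, t, ht, fun x => (congrArg (· + t) (Weyl.act_one x)).symm⟩)

omit [IsOrderedAddMonoid Λ] [IsOrderedModule F Λ] in
lemma IsAffineBuilding.exists_transition (hX : IsAffineBuilding P B T 𝒜)
    {f g : ModelSpace Λ P → X} (hf : f ∈ 𝒜) (hg : g ∈ 𝒜) {x : ModelSpace Λ P}
    (hx : f x ∈ Set.range g) : ∃ w : Weyl P, ∃ t ∈ T, ∀ y, f y ∈ Set.range g →
      f y = g (w.act y + t) := by
  obtain ⟨u, hu, hfg⟩ := hX.compatible f hf g hg ⟨f x, ⟨x, rfl⟩, hx⟩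
  obtain ⟨w, t, ht, hw⟩ := mem_affineWeylGroup_iff.1 hu
  exact ⟨w, t, ht, fun y hy => by rw [← hw]; exact hfg hy⟩

/-- Two maps agree on a translate of the fundamental chamber. -/
def EqFar (B : Set ι) (f g : ModelSpace Λ P → X) : Prop := ∃ p, ∀ x ∈ cone B p, f x = g x

omit [IsOrderedAddMonoid Λ] [IsOrderedModule F Λ] [Fintype ι] in
lemma EqFar.refl (f : ModelSpace Λ P → X) : EqFar B f f := ⟨0, fun _ _ => rfl⟩

omit [IsOrderedAddMonoid Λ] [IsOrderedModule F Λ] [Fintype ι] in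
lemma EqFar.symm {f g : ModelSpace Λ P → X} (h : EqFar B f g) : EqFar B g f :=
  ⟨h.choose, fun x hx => (h.choose_spec x hx).symm⟩

lemma EqFar.trans [P.IsRootSystem] (hB : IsRootBasis P B) {f g h : ModelSpace Λ P → X}
    (h1 : EqFar B f g) (h2 : EqFar B g h) : EqFar B f h := by
  obtain ⟨p, hp⟩ := h1
  obtain ⟨q, hq⟩ := h2
  obtain ⟨r, hr⟩ := hB.exists_cone_subset p q
  exact ⟨r, fun x hx => (hp x (hr hx).1).trans (hq x (hr hx).2)⟩

omit [IsOrderedModule F Λ] [Fintype ι] in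
lemma EqFar.comp_add {f g : ModelSpace Λ P → X} (h : EqFar B f g) (t : ModelSpace Λ P) :
    EqFar B (fun x => f (x + t)) (fun x => g (x + t)) := by
  obtain ⟨p, hp⟩ := h
  refine ⟨p - t, fun x hx => hp _ fun i hi => ?_⟩
  have := hx i hi
  rw [map_sub] at this
  rw [map_add]
  exact sub_le_iff_le_add.1 this

/-- Charts agreeing on a chamber agree on the intersection of their apartments. -/
lemma IsAffineBuilding.eq_of_eqFar [P.IsRootSystem] [Nontrivial Λ]
    (hX : IsAffineBuilding P B T 𝒜) (hB : IsRootBasis P B) {f g : ModelSpace Λ P → X}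
    (hf : f ∈ 𝒜) (hg : g ∈ 𝒜) (h : EqFar B f g) {x : ModelSpace Λ P} (hx : f x ∈ Set.range g) :
    f x = g x := by
  obtain ⟨p, hp⟩ := h
  obtain ⟨w, t, -, hw⟩ := hX.exists_transition hf hg hx
  obtain ⟨h1, h2⟩ := hB.eq_of_act_add_eq (v := 1) (w := w) (p := p) (t := 0) (t' := t)
    fun y hy => by
      have h3 := hp y hy
      rw [Weyl.act_one, add_zero]
      exact hX.injective g hg (h3.symm.trans (hw y ⟨y, h3.symm⟩))
  rw [hw x hx, ← h1, ← h2, Weyl.act_one, add_zero]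

lemma IsAffineBuilding.eq_of_eqFar_act [P.IsRootSystem] [Nontrivial Λ]
    (hX : IsAffineBuilding P B T 𝒜) (hB : IsRootBasis P B) {f g : ModelSpace Λ P → X}
    (hf : f ∈ 𝒜) (hg : g ∈ 𝒜) {w : Weyl P} (h : EqFar B (f ∘ w.act) (g ∘ w.act))
    {x : ModelSpace Λ P} (hx : f x ∈ Set.range g) : f x = g x := by
  have h1 := hX.eq_of_eqFar hB (hX.comp_act_mem hf w) (hX.comp_act_mem hg w) h
    (x := w⁻¹.act x) (by
      obtain ⟨y, hy⟩ := hx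
      exact ⟨w⁻¹.act y, by simp only [Function.comp_apply, Weyl.act_act_inv, hy]⟩)
  simpa only [Function.comp_apply, Weyl.act_act_inv] using h1

/-! ### Chambers at infinity -/

/-- The images of the fundamental chamber under two charts represent the same chamber at
infinity. -/
def Asymp (T : AddSubgroup (ModelSpace Λ P)) (B : Set ι) (f g : ModelSpace Λ P → X) : Prop :=
  ∃ t ∈ T, EqFar B f (fun x => g (x + t))

omit [IsOrderedAddMonoid Λ] [IsOrderedModule F Λ] [Fintype ι] in
lemma EqFar.asymp {f g : ModelSpace Λ P → X} (h : EqFar B f g) : Asymp T B f g :=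
  ⟨0, T.zero_mem, by simpa only [add_zero] using h⟩

omit [IsOrderedAddMonoid Λ] [IsOrderedModule F Λ] [Fintype ι] in
lemma Asymp.refl (f : ModelSpace Λ P → X) : Asymp T B f f := (EqFar.refl f).asymp

omit [IsOrderedModule F Λ] [Fintype ι] in
lemma Asymp.symm {f g : ModelSpace Λ P → X} (h : Asymp T B f g) : Asymp T B g f := by
  obtain ⟨t, ht, h⟩ := h
  refine ⟨-t, T.neg_mem ht, ?_⟩
  simpa only [neg_add_cancel_right] using (h.comp_add (-t)).symm

lemma Asymp.trans [P.IsRootSystem] (hB : IsRootBasis P B) {f g h : ModelSpace Λ P → X}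
    (h1 : Asymp T B f g) (h2 : Asymp T B g h) : Asymp T B f h := by
  obtain ⟨t, ht, h1⟩ := h1
  obtain ⟨t', ht', h2⟩ := h2
  refine ⟨t + t', T.add_mem ht ht', h1.trans hB ?_⟩
  simpa only [add_assoc] using h2.comp_add t

/-- The chamber at infinity of `g` is in position `v` relative to the chamber at infinity
of `f`. -/
def RelPos (T : AddSubgroup (ModelSpace Λ P)) (B : Set ι) (𝒜 : Set (ModelSpace Λ P → X))
    (v : Weyl P) (f g : ModelSpace Λ P → X) : Prop :=
  ∃ h ∈ 𝒜, Asymp T B f h ∧ Asymp T B g (h ∘ v.act)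

lemma RelPos.congr [P.IsRootSystem] (hB : IsRootBasis P B) {v : Weyl P}
    {f f' g g' : ModelSpace Λ P → X} (h : RelPos T B 𝒜 v f g) (hf : Asymp T B f' f)
    (hg : Asymp T B g' g) : RelPos T B 𝒜 v f' g' := by
  obtain ⟨k, hk, h1, h2⟩ := h
  exact ⟨k, hk, hf.trans hB h1, hg.trans hB h2⟩

omit [IsOrderedAddMonoid Λ] [IsOrderedModule F Λ] [Fintype ι] in
lemma relPos_comp_act {f : ModelSpace Λ P → X} (hf : f ∈ 𝒜) (v : Weyl P) :
    RelPos T B 𝒜 v f (f ∘ v.act) :=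
  ⟨f, hf, Asymp.refl f, Asymp.refl _⟩

omit [IsOrderedAddMonoid Λ] [IsOrderedModule F Λ] [Fintype ι] in
lemma relPos_self {f : ModelSpace Λ P → X} (hf : f ∈ 𝒜) : RelPos T B 𝒜 1 f f := by
  have h : f ∘ (1 : Weyl P).act = f := funext fun x => congrArg f (Weyl.act_one x)
  have := relPos_comp_act (T := T) (B := B) hf 1
  rwa [h] at this

lemma RelPos.asymp [P.IsRootSystem] (hB : IsRootBasis P B) {f g : ModelSpace Λ P → X}
    (h : RelPos T B 𝒜 1 f g) : Asymp T B f g := by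
  obtain ⟨k, -, h1, h2⟩ := h
  have h3 : k ∘ (1 : Weyl P).act = k := funext fun x => congrArg k (Weyl.act_one x)
  rw [h3] at h2
  exact h1.trans hB h2.symm

omit [IsOrderedAddMonoid Λ] [IsOrderedModule F Λ] in
lemma RelPos.symm (hX : IsAffineBuilding P B T 𝒜) {v : Weyl P} {f g : ModelSpace Λ P → X}
    (h : RelPos T B 𝒜 v f g) : RelPos T B 𝒜 v⁻¹ g f := by
  obtain ⟨k, hk, h1, h2⟩ := h
  refine ⟨k ∘ v.act, hX.comp_act_mem hk v, h2, ?_⟩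
  have h3 : (k ∘ v.act) ∘ v⁻¹.act = k := funext fun x => congrArg k (Weyl.act_act_inv v x)
  rwa [h3]

lemma RelPos.unique [P.IsRootSystem] [Nontrivial Λ] (hX : IsAffineBuilding P B T 𝒜)
    (hB : IsRootBasis P B) {v v' : Weyl P} {f g : ModelSpace Λ P → X}
    (h : RelPos T B 𝒜 v f g) (h' : RelPos T B 𝒜 v' f g) : v = v' := by
  obtain ⟨k, hk, h1, ⟨t₁, ht₁, p, hp⟩⟩ := h
  obtain ⟨k', hk', h1', ⟨t₂, ht₂, q, hq⟩⟩ := h'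
  obtain ⟨t₀, ht₀, h0⟩ := h1.symm.trans hB h1'
  obtain ⟨r, hr⟩ := hB.exists_cone_subset p q
  refine (hB.eq_of_act_add_eq (p := r) (t := v.act t₁ + t₀) (t' := v'.act t₂) fun x hx => ?_).1
  have h2 : k (v.act (x + t₁)) = k' (v'.act (x + t₂)) :=
    (hp x (hr hx).1).symm.trans (hq x (hr hx).2)
  have h3 := hX.eq_of_eqFar hB hk (hX.comp_add_mem hk' ht₀) h0 (x := v.act (x + t₁))
    ⟨v'.act (x + t₂) - t₀, by simp only [sub_add_cancel, h2]⟩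
  have h4 := hX.injective k' hk' (h3.symm.trans h2)
  rw [map_add, map_add] at h4
  rw [← add_assoc, h4]

/-- Any two chambers at infinity lie in a common apartment. -/
lemma IsAffineBuilding.exists_relPos [P.IsRootSystem] [Nontrivial Λ]
    (hX : IsAffineBuilding P B T 𝒜) (hB : IsRootBasis P B) (hT : IsTranslationGroup P T)
    {f g : ModelSpace Λ P → X} (hf : f ∈ 𝒜) (hg : g ∈ 𝒜) : ∃ v, RelPos T B 𝒜 v f g := by
  have hC : IsWeylChamber P B (fundamentalChamber Λ P B) :=
    ⟨id, mem_affineWeylGroup_iff.2 ⟨1, 0, trivial, fun x => by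
      rw [Weyl.act_one, add_zero]; rfl⟩, (Set.image_id _).symm⟩
  have hcone : fundamentalChamber Λ P B = cone B 0 := by
    ext x
    simp only [fundamentalChamber, cone, map_zero]
  -- The subchamber `S` comes from an unrelated chart `k`. Lying inside a chamber of `f`, it must
  -- have the same direction, so it is the image under `f` of a whole cone; there `f` and `h` differ
  -- by an affine Weyl element.
  have key : ∀ f ∈ 𝒜, ∀ S, IsChamberOf P B 𝒜 S → S ⊆ f '' fundamentalChamber Λ P B →
      ∀ h ∈ 𝒜, S ⊆ Set.range h → ∃ w : Weyl P, ∃ t ∈ T, ∃ p, ∀ x ∈ cone B p,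
        f x = h (w.act x + t) := by
    rintro f hf S ⟨k, hk, C, ⟨u, hu, rfl⟩, rfl⟩ hSf h hh hSh
    obtain ⟨w, t, -, hw⟩ := mem_affineWeylGroup_iff.1 hu
    rw [hcone] at hSf hSh
    have h0 : ∀ x ∈ cone B (0 : ModelSpace Λ P), ∃ y ∈ cone B (0 : ModelSpace Λ P),
        f y = k (w.act x + t) := fun x hx => by
      rw [← hw]
      exact hSf ⟨_, ⟨x, hx, rfl⟩, rfl⟩
    obtain ⟨y₀, -, hy₀⟩ := h0 0 fun i _ => le_rfl
    obtain ⟨v, t', -, hv⟩ := hX.exists_transition hk hf ⟨y₀, hy₀⟩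
    have h1 : ∀ x ∈ cone B (0 : ModelSpace Λ P), (v * w).act x + (v.act t + t') ∈
        cone B (0 : ModelSpace Λ P) ∧ f ((v * w).act x + (v.act t + t')) = k (w.act x + t) := by
      intro x hx
      obtain ⟨y, hy, hyk⟩ := h0 x hx
      have h2 := hv _ ⟨y, hyk⟩
      rw [map_add, ← Weyl.act_mul, add_assoc] at h2
      have h3 := hX.injective f hf (hyk.trans h2)
      rw [← h3]
      exact ⟨hy, hyk⟩
    have hvw := hB.eq_one_of_act_cone_subset fun x hx => (h1 x hx).1
    have h2 : ∀ x ∈ cone B (v.act t + t'), f x ∈ Set.range h := by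
      intro x hx
      have hx' : x - (v.act t + t') ∈ cone B (0 : ModelSpace Λ P) := fun i hi => by
        rw [map_zero, map_sub]
        exact sub_nonneg.2 (hx i hi)
      have h3 := (h1 _ hx').2
      rw [hvw, Weyl.act_one, sub_add_cancel] at h3
      rw [h3, ← hw]
      exact hSh ⟨_, ⟨_, hx', rfl⟩, rfl⟩
    obtain ⟨w', t₁, ht₁, hw'⟩ := hX.exists_transition hf hh (h2 _ fun i _ => le_rfl)
    exact ⟨w', t₁, ht₁, _, fun x hx => hw' x (h2 x hx)⟩
  obtain ⟨S₁, S₂, hS₁, hS₂, hf₁, hg₂, h, hh, hS⟩ :=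
    hX.subchambers _ _ ⟨f, hf, _, hC, rfl⟩ ⟨g, hg, _, hC, rfl⟩
  obtain ⟨w, t, ht, p, hp⟩ := key f hf S₁ hS₁ hf₁ h hh (Set.subset_union_left.trans hS)
  obtain ⟨w', t', ht', q, hq⟩ := key g hg S₂ hS₂ hg₂ h hh (Set.subset_union_right.trans hS)
  refine ⟨w⁻¹ * w', h ∘ w.act, hX.comp_act_mem hh w, ⟨w⁻¹.act t, hT.act_mem _ ht, p,
    fun x hx => ?_⟩, ⟨w'⁻¹.act t', hT.act_mem _ ht', q, fun x hx => ?_⟩⟩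
  · simp only [Function.comp_apply]
    rw [map_add, Weyl.act_act_inv, hp x hx]
  · simp only [Function.comp_apply]
    rw [← Weyl.act_mul, mul_inv_cancel_left, map_add, Weyl.act_act_inv, hq x hx]

/-! ### Adjacency -/

/-- The chambers at infinity of `f` and `g` share the panel of type `b`. -/
def Adj [P.IsRootSystem] (𝒜 : Set (ModelSpace Λ P → X)) (hB : IsRootBasis P B) (b : B)
    (f g : ModelSpace Λ P → X) : Prop :=
  ∃ K, ∀ l : Λ, 0 ≤ l →
    atlasDist P B 𝒜 (f (hB.faceVector b ⊗ₜ l)) (g (hB.faceVector b ⊗ₜ l)) ≤ K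

/-- Shifting the ray to start at the apex `p` keeps it inside the cone, since `v` is dominant. The
detour through the shifted ray has constant length. -/
lemma Asymp.exists_atlasDist_le (hX : IsAffineBuilding P B T 𝒜) (hB : IsRootBasis P B)
    {f g : ModelSpace Λ P → X} (hf : f ∈ 𝒜) (hg : g ∈ 𝒜) (h : Asymp T B f g) {v : M}
    (hv : IsDominant P B v) :
    ∃ K, ∀ l : Λ, 0 ≤ l → atlasDist P B 𝒜 (f (v ⊗ₜ l)) (g (v ⊗ₜ l)) ≤ K := by
  obtain ⟨t, -, p, hp⟩ := h
  refine ⟨modelDist P B 0 p + modelDist P B (p + t) 0, fun l hl => ?_⟩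
  have h1 := hp (p + v ⊗ₜ l) fun i hi => by
    rw [map_add, coeval_tmul]
    exact le_add_of_nonneg_right (smul_nonneg (hv i hi) hl)
  refine (hX.atlasDist_triangle hB _ (f (p + v ⊗ₜ l)) _).trans (add_le_add ?_ ?_)
  · rw [hX.atlasDist_eq hB hf, ← modelDist_add_right 0 p (v ⊗ₜ l), zero_add]
  · rw [h1, hX.atlasDist_eq hB hg, ← modelDist_add_right (p + t) 0 (v ⊗ₜ l), zero_add,
      add_right_comm]

variable [P.IsRootSystem]

lemma Asymp.adj (hX : IsAffineBuilding P B T 𝒜) (hB : IsRootBasis P B) (b : B)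
    {f g : ModelSpace Λ P → X} (hf : f ∈ 𝒜) (hg : g ∈ 𝒜) (h : Asymp T B f g) : Adj 𝒜 hB b f g :=
  h.exists_atlasDist_le hX hB hf hg (hB.isDominant_faceVector b)

omit [IsOrderedModule F Λ] in
lemma Adj.symm (hX : IsAffineBuilding P B T 𝒜) {hB : IsRootBasis P B} {b : B}
    {f g : ModelSpace Λ P → X} (h : Adj 𝒜 hB b f g) : Adj 𝒜 hB b g f :=
  ⟨h.choose, fun l hl => by
    rw [hX.atlasDist_comm hB]
    exact h.choose_spec l hl⟩

omit [IsOrderedModule F Λ] in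
lemma Adj.trans (hX : IsAffineBuilding P B T 𝒜) {hB : IsRootBasis P B} {b : B}
    {f g h : ModelSpace Λ P → X} (h1 : Adj 𝒜 hB b f g) (h2 : Adj 𝒜 hB b g h) : Adj 𝒜 hB b f h :=
  ⟨h1.choose + h2.choose, fun l hl => (hX.atlasDist_triangle hB _ _ _).trans
    (add_le_add (h1.choose_spec l hl) (h2.choose_spec l hl))⟩

omit [IsOrderedModule F Λ] in
lemma adj_comp_refl (hX : IsAffineBuilding P B T 𝒜) (hB : IsRootBasis P B) (b : B)
    {f : ModelSpace Λ P → X} (hf : f ∈ 𝒜) : Adj 𝒜 hB b f (f ∘ (Weyl.refl P b).act) := by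
  refine ⟨0, fun l _ => ?_⟩
  rw [Function.comp_apply, Weyl.act_tmul, hB.refl_faceVector, hX.atlasDist_eq hB hf]
  simp [modelDist]

/-- Up to bounded error, `x ⊗ l` in the chart `e` and the panel point of `f` at parameter `l` have
distance `l` times the left-hand norm. The panel points of `g` stay at bounded distance from those
of `f`. -/
lemma RelPos.rootNorm_le [Nontrivial Λ] (hX : IsAffineBuilding P B T 𝒜) (hB : IsRootBasis P B)
    {b : B} {v v' : Weyl P} {e f g : ModelSpace Λ P → X} (he : e ∈ 𝒜) (hf : f ∈ 𝒜) (hg : g ∈ 𝒜)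
    (h : RelPos T B 𝒜 v e f) (h' : RelPos T B 𝒜 v' e g) (hfg : Adj 𝒜 hB b f g) {x : M}
    (hx : IsDominant P B x) :
    rootNorm P B (x - v.1 (hB.faceVector b)) ≤ rootNorm P B (x - v'.1 (hB.faceVector b)) := by
  obtain ⟨k, hk, h1, h2⟩ := h
  obtain ⟨k', hk', h3, h4⟩ := h'
  obtain ⟨K₁, hK₁⟩ := h1.exists_atlasDist_le hX hB he hk hx
  obtain ⟨K₂, hK₂⟩ := h2.symm.exists_atlasDist_le hX hB (hX.comp_act_mem hk v) hf
    (hB.isDominant_faceVector b)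
  obtain ⟨K₃, hK₃⟩ := h3.symm.exists_atlasDist_le hX hB hk' he hx
  obtain ⟨K₄, hK₄⟩ := h4.exists_atlasDist_le hX hB hg (hX.comp_act_mem hk' v')
    (hB.isDominant_faceVector b)
  obtain ⟨K₅, hK₅⟩ := hfg
  refine le_of_forall_smul_le (Λ := Λ) (K := K₂ + K₅ + K₄ + K₃ + K₁) fun l hl => ?_
  have t1 := hX.atlasDist_triangle hB (k (v.act (hB.faceVector b ⊗ₜ l)))
    (f (hB.faceVector b ⊗ₜ l)) (k (x ⊗ₜ l))
  have t2 := hX.atlasDist_triangle hB (f (hB.faceVector b ⊗ₜ l))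
    (g (hB.faceVector b ⊗ₜ l)) (k (x ⊗ₜ l))
  have t3 := hX.atlasDist_triangle hB (g (hB.faceVector b ⊗ₜ l))
    (k' (v'.act (hB.faceVector b ⊗ₜ l))) (k (x ⊗ₜ l))
  have t4 := hX.atlasDist_triangle hB (k' (v'.act (hB.faceVector b ⊗ₜ l)))
    (k' (x ⊗ₜ l)) (k (x ⊗ₜ l))
  have t5 := hX.atlasDist_triangle hB (k' (x ⊗ₜ l)) (e (x ⊗ₜ l)) (k (x ⊗ₜ l))
  have d1 := hX.atlasDist_eq hB hk (v.act (hB.faceVector b ⊗ₜ l)) (x ⊗ₜ l)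
  have d2 := hX.atlasDist_eq hB hk' (v'.act (hB.faceVector b ⊗ₜ l)) (x ⊗ₜ l)
  rw [Weyl.act_tmul, modelDist_tmul _ _ hl] at d1 d2
  rw [← d1, ← d2]
  have b1 := hK₁ l hl
  have b2 := hK₂ l hl
  have b3 := hK₃ l hl
  have b4 := hK₄ l hl
  have b5 := hK₅ l hl
  simp only [Function.comp_apply, Weyl.act_tmul] at *
  calc _ ≤ _ := t1
    _ ≤ _ := add_le_add b2 (t2.trans (add_le_add b5 (t3.trans (add_le_add b4
      (t4.trans (add_le_add le_rfl (t5.trans (add_le_add b3 b1))))))))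
    _ = _ := by abel

/-- The panel vectors moved by the two positions lie in one orbit and have equal distance to every
dominant vector, so they coincide. The stabilizer of a panel vector is `{1, s_b}`. -/
lemma RelPos.adj [Nontrivial Λ] (hX : IsAffineBuilding P B T 𝒜) (hB : IsRootBasis P B)
    (hT : IsTranslationGroup P T) {b : B} {v : Weyl P} {e f g : ModelSpace Λ P → X} (he : e ∈ 𝒜)
    (hf : f ∈ 𝒜) (hg : g ∈ 𝒜) (h : RelPos T B 𝒜 v e f) (hfg : Adj 𝒜 hB b f g) :
    RelPos T B 𝒜 v e g ∨ RelPos T B 𝒜 (v * Weyl.refl P b) e g := by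
  obtain ⟨v', h'⟩ := hX.exists_relPos hB hT he hg
  have h1 : (v' * v⁻¹).1 (v.1 (hB.faceVector b)) = v'.1 (hB.faceVector b) := by
    change v'.1 (v.1.symm (v.1 _)) = _
    rw [LinearEquiv.symm_apply_apply]
  have h2 := hB.apply_eq_of_rootNorm_eq (a := v.1 (hB.faceVector b)) (w := v' * v⁻¹)
    fun x hx => by
      rw [h1]
      exact le_antisymm (h.rootNorm_le hX hB he hf hg h' hfg hx)
        (h'.rootNorm_le hX hB he hg hf h (hfg.symm hX) hx)
  rw [h1] at h2
  have h3 : (v⁻¹ * v').1 (hB.faceVector b) = hB.faceVector b := by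
    change v.1.symm (v'.1 _) = _
    rw [h2, LinearEquiv.symm_apply_apply]
  rcases hB.eq_one_or_refl_of_faceVector h3 with h4 | h4
  · left
    rwa [inv_mul_eq_one.1 h4]
  · right
    rwa [← h4, mul_inv_cancel_left]

lemma Adj.relPos_refl [Nontrivial Λ] (hX : IsAffineBuilding P B T 𝒜) (hB : IsRootBasis P B)
    (hT : IsTranslationGroup P T) {b : B} {f g : ModelSpace Λ P → X}
    (hf : f ∈ 𝒜) (hg : g ∈ 𝒜) (h : Adj 𝒜 hB b f g) (hne : ¬ Asymp T B f g) :
    RelPos T B 𝒜 (Weyl.refl P b) f g := by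
  rcases (relPos_self hf).adj hX hB hT hf hf hg h with h1 | h1
  · exact absurd (h1.asymp hB) hne
  · rwa [one_mul] at h1

/-- The gate property: a panel containing a chamber almost opposite to `p` has no other such
chamber. -/
lemma RelPos.gate [Nontrivial Λ] (hX : IsAffineBuilding P B T 𝒜) (hB : IsRootBasis P B)
    (hT : IsTranslationGroup P T) {w : Weyl P} (hw : IsLongest B w) {b : B}
    {p q q' : ModelSpace Λ P → X} (hp : p ∈ 𝒜) (hq : q ∈ 𝒜) (hq' : q' ∈ 𝒜)
    (h : RelPos T B 𝒜 (w * Weyl.refl P b) p q) (hqq : Adj 𝒜 hB b q q')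
    (hne : ¬ Asymp T B q q') : RelPos T B 𝒜 w p q' := by
  rcases h.adj hX hB hT hp hq hq' hqq with h1 | h1
  · exfalso
    have hinv : (w * Weyl.refl P b)⁻¹ = Weyl.refl P b * w := by
      rw [mul_inv_rev, Weyl.refl_inv, inv_eq_of_mul_eq_one_right (hw.mul_self hB)]
    have h2 := h1.symm hX
    have h3 := h.symm hX
    rw [hinv] at h2 h3
    obtain ⟨k, hk, hk1, hk2⟩ := h2
    -- Walk in the apartment of `k` from `q'` to `p`, recording the position `v` relative to `q`.
    -- Each step changes `v` by at most one simple reflection, and `s_b v` starts at `1`, so it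
    -- never has more inversions than `u`. On arrival `u = v = s_b w`, and `w` would have no more
    -- inversions than `s_b w`.
    have key : ∀ u : Weyl P, ∃ v, RelPos T B 𝒜 v q (k ∘ u.act) ∧
        inversionCount B (Weyl.refl P b * v) ≤ inversionCount B u := by
      intro u
      induction u using hB.weyl_induction with
      | one =>
        refine ⟨Weyl.refl P b, ?_, ?_⟩
        · have h4 : k ∘ (1 : Weyl P).act = k := funext fun x => congrArg k (Weyl.act_one x)
          rw [h4]
          exact (hqq.relPos_refl hX hB hT hq hq' hne).congr hB (Asymp.refl _) hk1.symm
        · rw [Weyl.refl_mul_self]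
      | mul_refl u c hu ih =>
        obtain ⟨v, hv, hle⟩ := ih
        have h4 : k ∘ (u * Weyl.refl P c).act = (k ∘ u.act) ∘ (Weyl.refl P c).act :=
          funext fun x => congrArg k (Weyl.act_mul u _ x)
        have hku := hX.comp_act_mem hk u
        have hadj := adj_comp_refl hX hB c hku
        rw [h4, hB.inversionCount_mul_refl hu]
        rcases hv.adj hX hB hT hq hku (hX.comp_act_mem hku _) hadj with h5 | h5
        · exact ⟨v, h5, hle.trans (Nat.le_add_right _ _)⟩
        · refine ⟨_, h5, ?_⟩
          rw [← mul_assoc]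
          exact (hB.inversionCount_mul_refl_le _ c).trans (Nat.add_le_add_right hle _)
    obtain ⟨v, hv, hle⟩ := key (Weyl.refl P b * w)
    have h4 := RelPos.unique hX hB (hv.congr hB (Asymp.refl _) hk2) h3
    rw [h4, ← mul_assoc, Weyl.refl_mul_self, one_mul] at hle
    refine hle.not_gt ?_
    have hb := IsRootBasis.isPositive_of_mem (P := P) b.2
    refine hw.inversionCount_lt (j := P.reflectionPerm (w.perm b) (w.perm b))
      ((hB.isPositive_neg_iff _).2 (hw b hb)) ?_
    rw [← Weyl.perm_neg, Weyl.perm_mul_apply, ← Weyl.perm_mul_apply w w, hw.mul_self hB,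
      Weyl.perm_one_apply, Weyl.perm_neg, hB.isPositive_neg_iff, Weyl.perm_refl_apply,
      hB.isPositive_neg_iff, not_not]
    exact hb
  · rwa [Weyl.mul_refl_mul_refl] at h1

end Building

section Exchange

variable {F : Subfield ℝ} {ι M N : Type*} [AddCommGroup M] [Module F M]
  [AddCommGroup N] [Module F N] {P : RootPairing ι F M N} [P.IsRootSystem] {B : Set ι}
  {Λ : Type*} [AddCommGroup Λ] [Module F Λ] [LinearOrder Λ] [IsOrderedAddMonoid Λ]
  [IsOrderedModule F Λ] [Fintype ι] {X : Type*} {T : AddSubgroup (ModelSpace Λ P)}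
  {𝒜 : Set (ModelSpace Λ P → X)}

/-! ### Exchanging half-apartments -/

omit [P.IsRootSystem] [IsOrderedAddMonoid Λ] [IsOrderedModule F Λ] [Fintype ι] in
lemma asymp_comp_add (hT : IsTranslationGroup P T) (f : ModelSpace Λ P → X) {t : ModelSpace Λ P}
    (ht : t ∈ T) (w : Weyl P) : Asymp T B (f ∘ w.act) ((fun x => f (x + t)) ∘ w.act) := by
  refine ⟨-w⁻¹.act t, T.neg_mem (hT.act_mem _ ht), 0, fun x _ => ?_⟩
  simp only [Function.comp_apply, map_add, map_neg, Weyl.act_act_inv, neg_add_cancel_right]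

/-- Asymptotic charts may differ by a translation, but they supply points of the intersection of the
apartments. There the charts agree outright because they agree on one cone. -/
lemma EqFar.comp_act [Nontrivial Λ] (hX : IsAffineBuilding P B T 𝒜) (hB : IsRootBasis P B)
    {f g : ModelSpace Λ P → X} (hf : f ∈ 𝒜) (hg : g ∈ 𝒜) (h : EqFar B f g) {w : Weyl P}
    (hw : Asymp T B (f ∘ w.act) (g ∘ w.act)) : EqFar B (f ∘ w.act) (g ∘ w.act) := by
  obtain ⟨t, -, p, hp⟩ := hw
  exact ⟨p, fun x hx => hX.eq_of_eqFar hB hf hg h ⟨_, (hp x hx).symm⟩⟩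

lemma not_asymp_comp_refl [Nontrivial Λ] (hX : IsAffineBuilding P B T 𝒜) (hB : IsRootBasis P B)
    {f : ModelSpace Λ P → X} (hf : f ∈ 𝒜) (b : B) :
    ¬ Asymp T B f (f ∘ (Weyl.refl P b).act) := fun h =>
  Weyl.refl_ne_one hB b (RelPos.unique hX hB (relPos_comp_act (T := T) hf _)
    ((relPos_self hf).congr hB (Asymp.refl _) h.symm))

/-- A half-apartment and a chamber at infinity on a panel of its boundary lie in a common
apartment. -/
lemma IsAffineBuilding.exists_half [Nontrivial Λ] (hX : IsAffineBuilding P B T 𝒜)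
    (hB : IsRootBasis P B) (hT : IsTranslationGroup P T) {w : Weyl P} (hw : IsLongest B w) (b : B)
    {g k : ModelSpace Λ P → X} (hg : g ∈ 𝒜) (hk : k ∈ 𝒜) (hadj : Adj 𝒜 hB b k g)
    (hne : ¬ Asymp T B k g) (hne' : ¬ Asymp T B k (g ∘ (Weyl.refl P b).act)) :
    ∃ g' ∈ 𝒜, EqFar B g g' ∧ (∃ e, g ⁻¹' Set.range g' = halfApartment P b e) ∧
      Asymp T B k (g' ∘ (Weyl.refl P b).act) ∧
      EqFar B (g ∘ (Weyl.refl P b * w).act) (g' ∘ (Weyl.refl P b * w).act) := by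
  set s := Weyl.refl P b with hs
  have hss : s * s = 1 := Weyl.refl_mul_self _
  have hww : w * w = 1 := hw.mul_self hB
  have hd := hX.comp_act_mem hg (s * w)
  -- This chamber is opposite to `g ∘ s.act` and almost opposite to `g`, so the gate property makes
  -- it opposite to `k`.
  have hdg : RelPos T B 𝒜 (w * s) (g ∘ (s * w).act) g := by
    have := relPos_comp_act (T := T) (B := B) hd (w * s)
    rwa [Weyl.comp_act_comp_act, ← mul_assoc, mul_assoc s w w, hww, mul_one, hss,
      Weyl.comp_act_one] at this
  obtain ⟨h, hh, h1, h2⟩ := hdg.gate hX hB hT hw hd hg hk (hadj.symm hX) fun h => hne h.symm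
  have hh' := hX.comp_act_mem hh (w * s)
  have e1 : h ∘ w.act = (h ∘ (w * s).act) ∘ s.act := by
    rw [Weyl.comp_act_comp_act, mul_assoc, hss, mul_one]
  have e2 : h = (h ∘ (w * s).act) ∘ (s * w).act := by
    rw [Weyl.comp_act_comp_act, ← mul_assoc, mul_assoc w s s, hss, mul_one, hww,
      Weyl.comp_act_one]
  have h3 : RelPos T B 𝒜 (w * s) (g ∘ (s * w).act) (h ∘ (w * s).act) :=
    (relPos_comp_act hh (w * s)).congr hB h1 (Asymp.refl _)
  rw [e1] at h2
  have h4 : Adj 𝒜 hB b g (h ∘ (w * s).act) :=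
    ((hadj.symm hX).trans hX (h2.adj hX hB b hk (hX.comp_act_mem hh' s))).trans hX
      ((adj_comp_refl hX hB b hh').symm hX)
  -- In the apartment `h` of the opposite pair, the neighbour of `k` on the panel is almost opposite
  -- to the same chamber as `g`. Only one chamber of the panel has that position.
  have h5 : Asymp T B g (h ∘ (w * s).act) := by
    by_contra hne
    have h6 := RelPos.unique hX hB h3 (hdg.gate hX hB hT hw hd hg hh' h4 hne)
    exact Weyl.refl_ne_one hB b (mul_eq_left.1 h6)
  obtain ⟨t, ht, h5⟩ := h5
  have hg' := hX.comp_add_mem hh' ht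
  have h6 : Asymp T B k ((fun x => (h ∘ (w * s).act) (x + t)) ∘ s.act) :=
    h2.trans hB (asymp_comp_add hT _ ht s)
  have h7 : EqFar B (g ∘ (s * w).act) ((fun x => (h ∘ (w * s).act) (x + t)) ∘ (s * w).act) := by
    refine h5.comp_act hX hB hg hg' (h1.trans hB ?_)
    conv_lhs => rw [e2]
    exact asymp_comp_add hT _ ht (s * w)
  refine ⟨_, hg', h5, ?_, h6, h7⟩
  obtain ⟨p, hp⟩ := id h5
  obtain ⟨q, hq⟩ := id h7
  rcases hB.eq_univ_or_halfApartment hw b (hX.convex_inter g hg _ hg'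
    ⟨g p, ⟨p, rfl⟩, ⟨p, (hp p fun _ _ => le_rfl).symm⟩⟩)
    (fun x hx => ⟨x, (hp x hx).symm⟩) (fun x hx => ⟨_, (hq x hx).symm⟩) with hY | hY
  · exfalso
    refine hne' ?_
    have h8 : g = fun x => (h ∘ (w * s).act) (x + t) := funext fun x =>
      hX.eq_of_eqFar hB hg hg' h5 (by
        have hx := Set.mem_univ x
        rw [← hY] at hx
        exact hx)
    rw [h8]
    exact h6
  · exact hY

/-- Given charts `f` and `g` that share a chamber at infinity, a point `g a` lies in an apartment
that contains the adjacent chamber of `f` at infinity; either its coordinates are unchanged, or they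
move in the direction of the root. -/
lemma IsAffineBuilding.exists_step [Nontrivial Λ] (hX : IsAffineBuilding P B T 𝒜)
    (hB : IsRootBasis P B) (hT : IsTranslationGroup P T) (b : B)
    {f g : ModelSpace Λ P → X} (hf : f ∈ 𝒜) (hg : g ∈ 𝒜) (hfg : EqFar B f g)
    (a : ModelSpace Λ P) :
    (∃ g' ∈ 𝒜, g' a = g a ∧ EqFar B (f ∘ (Weyl.refl P b).act) (g' ∘ (Weyl.refl P b).act) ∧
      ∃ e, ∀ x, e ≤ coeval P b x → g' x = g x) ∨
    ∃ g' ∈ 𝒜, ∃ l : Λ, 0 < l ∧ g' (a + P.root b ⊗ₜ l) = g a ∧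
      EqFar B (f ∘ (Weyl.refl P b).act) (g' ∘ (Weyl.refl P b).act) := by
  obtain ⟨w, hw⟩ : ∃ w : Weyl P, IsLongest B w := hB.exists_longest
  obtain ⟨b', hb'⟩ := hw.exists_mul_refl hB b
  set s := Weyl.refl P b with hs
  by_cases h0 : Asymp T B (f ∘ s.act) (g ∘ s.act)
  · exact Or.inl ⟨g, hg, rfl, hfg.comp_act hX hB hf hg h0, 0, fun _ _ => rfl⟩
  have hss : s * s = 1 := Weyl.refl_mul_self _
  have hww : w * w = 1 := hw.mul_self hB
  have hssw : s * (s * w) = w := by rw [← mul_assoc, hss, one_mul]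
  have hsb : s * w * Weyl.refl P b' = w := by rw [hb', Weyl.mul_refl_mul_refl]
  have hk := hX.comp_act_mem hf s
  have hgs := hX.comp_act_mem hg s
  have hgss : (g ∘ s.act) ∘ s.act = g := by rw [Weyl.comp_act_comp_act, hss, Weyl.comp_act_one]
  have hkg : Adj 𝒜 hB b (f ∘ s.act) g :=
    ((adj_comp_refl hX hB b hf).symm hX).trans hX (hfg.asymp.adj hX hB b hf hg)
  have hne : ¬ Asymp T B (f ∘ s.act) g := fun h =>
    not_asymp_comp_refl hX hB hf b (hfg.asymp.trans hB h.symm)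
  -- The apartment of `g₂` keeps the half of `g` on the side of the chamber shared with `f`; that of
  -- `g₃'` keeps a half on the other side. Both have the new chamber at infinity.
  obtain ⟨g₂, hg₂, h21, ⟨e, h22⟩, h23, h24⟩ := hX.exists_half hB hT hw b hg hk hkg hne h0
  obtain ⟨g₃', hg₃', h31, ⟨e', h32⟩, h33, h34⟩ := hX.exists_half hB hT hw b hgs hk
    (hkg.trans hX (adj_comp_refl hX hB b hg)) h0 (by rw [hgss]; exact hne)
  rw [Weyl.comp_act_comp_act, hssw] at h34
  have hgw := hX.comp_act_mem hg w
  have hgsw := hX.comp_act_mem hg (s * w)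
  have hg₂s := hX.comp_act_mem hg₂ s
  have hg₂w := hX.comp_act_mem hg₂ w
  have hg₂sw := hX.comp_act_mem hg₂ (s * w)
  have hg₃'w := hX.comp_act_mem hg₃' w
  have hg₃'sw := hX.comp_act_mem hg₃' (s * w)
  have hrel : ∀ h ∈ 𝒜, Asymp T B (f ∘ s.act) (h ∘ s.act) →
      RelPos T B 𝒜 (w * Weyl.refl P b') (f ∘ s.act) (h ∘ w.act) := by
    intro h hh hkh
    have := relPos_comp_act (T := T) (B := B) (hX.comp_act_mem hh s) (s * w)
    rw [Weyl.comp_act_comp_act, hssw, hb'] at this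
    exact this.congr hB hkh (Asymp.refl _)
  -- Both chambers lie on the panel of type `b'` shared by `g ∘ w.act` and `g ∘ (s * w).act`, and
  -- both are almost opposite to the new chamber. The gate property then identifies them, so the
  -- apartments of `g₂` and `g₃'` also share a half.
  have hadj : Adj 𝒜 hB b' (g₂ ∘ w.act) (g₃' ∘ w.act) := by
    have a1 := adj_comp_refl hX hB b' hg₂w
    rw [Weyl.comp_act_comp_act, ← hb'] at a1
    have a2 := h24.symm.asymp.adj hX hB b' hg₂sw hgsw
    have a3 := adj_comp_refl hX hB b' hgsw
    rw [Weyl.comp_act_comp_act, hsb] at a3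
    have a4 := h34.asymp.adj hX hB b' hgw hg₃'sw
    have a5 := adj_comp_refl hX hB b' hg₃'sw
    rw [Weyl.comp_act_comp_act, hsb] at a5
    exact (((a1.trans hX a2).trans hX a3).trans hX a4).trans hX a5
  have hopp : Asymp T B (g₂ ∘ w.act) (g₃' ∘ w.act) := by
    by_contra hcon
    have h1 := RelPos.unique hX hB (hrel g₃' hg₃' h33)
      ((hrel g₂ hg₂ h23).gate hX hB hT hw hk hg₂w hg₃'w hadj hcon)
    exact Weyl.refl_ne_one hB b' (mul_eq_left.1 h1)
  obtain ⟨t, ht, h23t⟩ := h23.symm.trans hB h33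
  have hst := hT.act_mem s ht
  -- The shift removes the translation between `g₂` and `g₃'` at the new chamber; it appears as
  -- `s.act t` because it is read through `s`.
  obtain ⟨g₃, hg₃def⟩ : ∃ g₃, g₃ = fun x => g₃' (x + s.act t) := ⟨_, rfl⟩
  have hg₃ : g₃ ∈ 𝒜 := hg₃def ▸ hX.comp_add_mem hg₃' hst
  have hg₃s := hX.comp_act_mem hg₃ s
  have h3' : ∀ x, g₃' x = g₃ (x - s.act t) := fun x => by rw [hg₃def]; simp only [sub_add_cancel]
  have h23' : EqFar B (g₂ ∘ s.act) (g₃ ∘ s.act) := by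
    rw [hg₃def]
    simpa only [Function.comp_def, map_add] using h23t
  have hr3 : Set.range g₃ = Set.range g₃' := by
    rw [hg₃def]
    exact (Equiv.addRight (s.act t)).surjective.range_comp g₃'
  have hopp' : EqFar B ((g₂ ∘ s.act) ∘ (s * w).act) ((g₃ ∘ s.act) ∘ (s * w).act) := by
    refine h23'.comp_act hX hB hg₂s hg₃s ?_
    rw [Weyl.comp_act_comp_act, Weyl.comp_act_comp_act, hssw, hg₃def]
    exact hopp.trans hB (asymp_comp_add hT g₃' hst w)
  have hhalf : ∃ e'', (g₂ ∘ s.act) ⁻¹' Set.range (g₃ ∘ s.act) = halfApartment P b e'' := by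
    obtain ⟨p, hp⟩ := id h23'
    obtain ⟨q, hq⟩ := id hopp'
    rcases hB.eq_univ_or_halfApartment hw b (hX.convex_inter _ hg₂s _ hg₃s
      ⟨_, ⟨p, rfl⟩, ⟨p, (hp p fun _ _ => le_rfl).symm⟩⟩)
      (fun x hx => ⟨x, (hp x hx).symm⟩) (fun x hx => ⟨_, (hq x hx).symm⟩) with hY | hY
    · exfalso
      have h1 : g₂ = g₃ := funext fun x => hX.eq_of_eqFar_act hB hg₂ hg₃ h23' (by
        have : s⁻¹.act x ∈ (g₂ ∘ s.act) ⁻¹' Set.range (g₃ ∘ s.act) := by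
          rw [hY]
          trivial
        rwa [Set.mem_preimage, Function.comp_apply, Weyl.act_act_inv, Weyl.range_comp_act] at this)
      have h2 : Asymp T B g₃' g₃ :=
        ⟨-s.act t, T.neg_mem hst, 0, fun x _ => by
          simp only [← sub_eq_add_neg, ← h3']⟩
      rw [← h1] at h2
      exact not_asymp_comp_refl hX hB hg b
        ((h21.asymp.trans hB h2.symm).trans hB h31.symm.asymp)
    · exact hY
  obtain ⟨e'', h232⟩ := hhalf
  rw [Weyl.range_comp_act] at h232
  obtain ⟨m, ⟨⟨c, hc⟩, hm2⟩, hm3⟩ := hX.inter_nonempty g hg g₂ hg₂ g₃ hg₃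
    ⟨g, hg, b, e, by rw [← h22, Set.image_preimage_eq_range_inter]⟩
    ⟨_, hg₂s, b, e'', by
      rw [← h232, Set.image_preimage_eq_range_inter, Weyl.range_comp_act]⟩
    ⟨_, hgs, b, e', by
      rw [← h32, Set.image_preimage_eq_range_inter, Weyl.range_comp_act, hr3]⟩
  subst hc
  have hc2 : g c = g₂ c := hX.eq_of_eqFar hB hg hg₂ h21 hm2
  have hc3 : g₂ c = g₃ c := hX.eq_of_eqFar_act hB hg₂ hg₃ h23' (by rw [← hc2]; exact hm3)
  have hce : e ≤ coeval P b c := by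
    have : c ∈ g ⁻¹' Set.range g₂ := hm2
    rwa [h22] at this
  have hfg₂ : EqFar B (f ∘ s.act) (g₂ ∘ s.act) := (hfg.trans hB h21).comp_act hX hB hf hg₂ h23
  have hhalf2 : ∀ x, e ≤ coeval P b x → g₂ x = g x := fun x hx => by
    have : x ∈ g ⁻¹' Set.range g₂ := by
      rw [h22]
      exact hx
    exact (hX.eq_of_eqFar hB hg hg₂ h21 this).symm
  by_cases hae : e ≤ coeval P b a
  · exact Or.inl ⟨g₂, hg₂, hhalf2 a hae, hfg₂, e, hhalf2⟩
  · right
    push Not at hae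
    have hsneg : ∀ x : ModelSpace Λ P, coeval P b (s.act x) = -coeval P b x := fun x => by
      rw [← coeval_neg_index]
      exact coeval_reflection P b b x
    have hgx : ∀ x, g x ∈ Set.range g₃' → g x = g₃ (s.act x - s.act t) := fun x hx => by
      rw [← h3', ← hX.eq_of_eqFar hB hgs hg₃' h31 (x := s.act x)] <;>
        rw [Function.comp_apply, Weyl.act_refl_refl]
      exact hx
    have hc' : g c ∈ Set.range g₃' := by rw [← hr3]; exact hm3
    have hce' : e' ≤ coeval P b (s.act c) := by
      have : s.act c ∈ (g ∘ s.act) ⁻¹' Set.range g₃' := by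
        rw [Set.mem_preimage, Function.comp_apply, Weyl.act_refl_refl]
        exact hc'
      rwa [h32] at this
    -- In the coordinates of `g` the second half is bounded above in the direction of `b`. It
    -- contains `c`, and `a` lies below `c`.
    have ha' : g a ∈ Set.range g₃' := by
      have : s.act a ∈ (g ∘ s.act) ⁻¹' Set.range g₃' := by
        rw [h32]
        refine hce'.trans ?_
        rw [hsneg, hsneg]
        exact neg_le_neg (hae.le.trans hce)
      rwa [Set.mem_preimage, Function.comp_apply, Weyl.act_refl_refl] at this
    -- The point `c` has the same coordinates in `g`, `g₂` and `g₃`, so the coordinate change from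
    -- `g` to `g₃` is the reflection in the wall through `c`. It moves `a` along the root by the
    -- difference of the two evaluations.
    have hcc : c = s.act c - s.act t :=
      hX.injective g₃ hg₃ ((hc2.trans hc3).symm.trans (hgx c hc'))
    refine ⟨g₃, hg₃, coeval P b c - coeval P b a, sub_pos.2 (hae.trans_le hce), ?_,
      hfg₂.trans hB h23'⟩
    rw [hgx a ha']
    congr 1
    have h1 : s.act t = s.act c - c := eq_sub_of_add_eq' (eq_sub_iff_add_eq.1 hcc)
    rw [h1, hs, Weyl.act_refl_apply, Weyl.act_refl_apply, TensorProduct.tmul_sub]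
    abel

end Exchange

section Segments

variable {F : Subfield ℝ} {ι M N : Type*} [AddCommGroup M] [Module F M]
  [AddCommGroup N] [Module F N] {P : RootPairing ι F M N} [P.IsRootSystem] {B : Set ι}
  {Λ : Type*} [AddCommGroup Λ] [Module F Λ] [LinearOrder Λ] [IsOrderedAddMonoid Λ]
  [IsOrderedModule F Λ] [Fintype ι] {X : Type*} {T : AddSubgroup (ModelSpace Λ P)}
  {𝒜 : Set (ModelSpace Λ P → X)}

/-! ### Segments -/

/-- Any point and any chamber at infinity lie in a common apartment. -/
lemma IsAffineBuilding.exists_eqFar_mem_range [Nontrivial Λ] (hX : IsAffineBuilding P B T 𝒜)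
    (hB : IsRootBasis P B) (hT : IsTranslationGroup P T) {f : ModelSpace Λ P → X} (hf : f ∈ 𝒜)
    (z : X) : ∃ g ∈ 𝒜, z ∈ Set.range g ∧ EqFar B f g := by
  obtain ⟨g₀, hg₀, hz₀, -⟩ := hX.common_apartment z z
  obtain ⟨v, h, hh, ⟨t, ht, hgh⟩, hfh⟩ := hX.exists_relPos hB hT hg₀ hf
  have hh' := hX.comp_add_mem hh ht
  -- The point is carried along a gallery from a chamber of its own apartment to that of `f`; only
  -- membership matters, not the coordinates.
  have key : ∀ u : Weyl P, ∃ g ∈ 𝒜, z ∈ Set.range g ∧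
      EqFar B ((fun x => h (x + t)) ∘ u.act) (g ∘ u.act) := by
    intro u
    induction u using hB.weyl_induction with
    | one =>
      rw [Weyl.comp_act_one]
      exact ⟨g₀, hg₀, hz₀, by rw [Weyl.comp_act_one]; exact hgh.symm⟩
    | mul_refl u b _ ih =>
      obtain ⟨g, hg, ⟨a, rfl⟩, hhg⟩ := ih
      have key := hX.exists_step hB hT b (hX.comp_act_mem hh' u) (hX.comp_act_mem hg u) hhg
        (u⁻¹.act a)
      simp only [Weyl.comp_act_comp_act, Function.comp_apply, Weyl.act_act_inv] at key
      have hfin : ∀ g' ∈ 𝒜, ∀ a', g' a' = g a →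
          EqFar B ((fun x => h (x + t)) ∘ (u * Weyl.refl P b).act) (g' ∘ (Weyl.refl P b).act) →
          ∃ g ∈ 𝒜, g' a' ∈ Set.range g ∧
            EqFar B ((fun x => h (x + t)) ∘ (u * Weyl.refl P b).act)
              (g ∘ (u * Weyl.refl P b).act) := by
        intro g' hg' a' _ he
        refine ⟨g' ∘ u⁻¹.act, hX.comp_act_mem hg' _, ?_, ?_⟩
        · rw [Weyl.range_comp_act]
          exact ⟨a', rfl⟩
        · rw [Weyl.comp_act_comp_act, inv_mul_cancel_left]
          exact he
      rcases key with ⟨g', hg', hz, he, -⟩ | ⟨g', hg', l, -, hz, he⟩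
      · rw [← hz]
        exact hfin g' hg' _ hz he
      · rw [← hz]
        exact hfin g' hg' _ hz he
  obtain ⟨g, hg, hz, hhg⟩ := key v
  obtain ⟨t', ht', h1⟩ := (hfh.trans hB (asymp_comp_add hT h ht v)).trans hB hhg.asymp
  refine ⟨_, hX.comp_add_mem (hX.comp_act_mem hg v) ht', ?_, h1⟩
  obtain ⟨a, rfl⟩ := hz
  exact ⟨v⁻¹.act a - t', by simp only [Function.comp_apply, sub_add_cancel, Weyl.act_act_inv]⟩

/-- Moving from a chamber at infinity of `f` to the opposite one, the coordinates of a point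
increase unless the point lies in an apartment containing both. -/
lemma IsAffineBuilding.exists_gallery [Nontrivial Λ] (hX : IsAffineBuilding P B T 𝒜)
    (hB : IsRootBasis P B) (hT : IsTranslationGroup P T) {f g₀ : ModelSpace Λ P → X} (hf : f ∈ 𝒜)
    (hg₀ : g₀ ∈ 𝒜) (h0 : EqFar B f g₀) (a₀ : ModelSpace Λ P) (u : Weyl P) :
    ∃ g ∈ 𝒜, ∃ a, g a = g₀ a₀ ∧ EqFar B (f ∘ u.act) (g ∘ u.act) ∧
      ((EqFar B f g ∧ a = a₀) ∨ coevalSum B a₀ < coevalSum B a) := by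
  induction u using hB.weyl_induction with
  | one =>
    refine ⟨g₀, hg₀, a₀, rfl, ?_, Or.inl ⟨h0, rfl⟩⟩
    rw [Weyl.comp_act_one, Weyl.comp_act_one]
    exact h0
  | mul_refl u b hub ih =>
    obtain ⟨g, hg, a, hga, hfg, hor⟩ := ih
    have key := hX.exists_step hB hT b (hX.comp_act_mem hf u) (hX.comp_act_mem hg u) hfg
      (u⁻¹.act a)
    simp only [Weyl.comp_act_comp_act, Function.comp_apply, Weyl.act_act_inv] at key
    rcases key with ⟨g', hg', hz, he, e, hge⟩ | ⟨g', hg', l, hl, hz, he⟩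
    · refine ⟨g' ∘ u⁻¹.act, hX.comp_act_mem hg' _, a, hz.trans hga, ?_, ?_⟩
      · rw [Weyl.comp_act_comp_act, inv_mul_cancel_left]
        exact he
      · refine hor.imp_left fun ⟨h1, h2⟩ => ⟨?_, h2⟩
        obtain ⟨p, hp⟩ := h1
        obtain ⟨q, hq⟩ := hB.exists_coeval_ge (P := P) (fun _ => e)
        obtain ⟨r, hr⟩ := hB.exists_cone_subset p q
        refine ⟨r, fun x hx => ?_⟩
        -- Since `u b` is a positive root, the half-apartment kept by this step contains a cone in
        -- the original direction, so the agreement with `f` there survives.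
        have h3 : e ≤ coeval P b (u⁻¹.act x) := by
          rw [Weyl.coeval_act, inv_inv]
          exact (hq _ hub).trans ((hr hx).2 _ hub)
        rw [hp x (hr hx).1, Function.comp_apply, hge _ h3, Weyl.act_act_inv]
    · refine ⟨g' ∘ u⁻¹.act, hX.comp_act_mem hg' _, u.act (u⁻¹.act a + P.root b ⊗ₜ l), ?_, ?_,
        Or.inr ?_⟩
      · rw [Function.comp_apply, Weyl.act_inv_act, hz, hga]
      · rw [Weyl.comp_act_comp_act, inv_mul_cancel_left]
        exact he
      · have h1 : coevalSum B a₀ ≤ coevalSum B a := by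
          rcases hor with ⟨-, h⟩ | h
          · rw [h]
          · exact h.le
        -- The displacement is `u b ⊗ l` with `u b` positive and `0 < l`, so `coevalSum` grows
        -- strictly.
        rw [map_add, Weyl.act_act_inv, Weyl.act_tmul, ← Weyl.root_perm, map_add, coevalSum_tmul]
        exact h1.trans_lt (lt_add_of_pos_right _ (lt_of_le_of_ne
          (smul_nonneg (hB.corootSum_pos hub).le hl.le)
          (smul_ne_zero (hB.corootSum_pos hub).ne' hl.ne').symm))

omit [LinearOrder Λ] [IsOrderedAddMonoid Λ] [IsOrderedModule F Λ] in
lemma IsLongest.coeval_act (hB : IsRootBasis P B) {w : Weyl P} (hw : IsLongest B w) {i : ι}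
    (hi : IsPositive P B i) : ∃ j, IsPositive P B j ∧ ∀ x : ModelSpace Λ P,
      coeval P i (w.act x) = -coeval P j x := by
  refine ⟨P.reflectionPerm (w.perm i) (w.perm i), (hB.isPositive_neg_iff _).2 (hw i hi),
    fun x => ?_⟩
  rw [coeval_neg_index, neg_neg, Weyl.coeval_act, inv_eq_of_mul_eq_one_right (hw.mul_self hB)]

/-- An apartment containing the chambers with direction `u` and `-u` of the segment contains it. -/
lemma IsAffineBuilding.seg_subset_range [Nontrivial Λ] (hX : IsAffineBuilding P B T 𝒜)
    (hB : IsRootBasis P B) (hT : IsTranslationGroup P T) {f : ModelSpace Λ P → X} (hf : f ∈ 𝒜)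
    {p q : ModelSpace Λ P} (hpq : ∀ i, IsPositive P B i → coeval P i p ≤ coeval P i q) :
    seg P B 𝒜 (f p) (f q) ⊆ Set.range f := by
  classical
  intro z hz
  obtain ⟨w, hw⟩ : ∃ w : Weyl P, IsLongest B w := hB.exists_longest
  obtain ⟨g₀, hg₀, ⟨a₀, rfl⟩, h0⟩ := hX.exists_eqFar_mem_range hB hT hf z
  obtain ⟨g, hg, a, hga, hfg, hor⟩ := hX.exists_gallery hB hT hf hg₀ h0 a₀ w
  rcases hor with ⟨h1, -⟩ | hlt
  · obtain ⟨r, hr⟩ := h1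
    obtain ⟨r', hr'⟩ := hfg
    have huniv := hB.eq_univ_of_opposite hw (hX.convex_inter g hg f hf
      ⟨f r, ⟨r, (hr r fun _ _ => le_rfl).symm⟩, ⟨r, rfl⟩⟩)
      (fun x hx => ⟨x, hr x hx⟩) (fun x hx => ⟨_, hr' x hx⟩)
    have ha := Set.mem_univ a
    rw [← huniv, Set.mem_preimage, hga] at ha
    exact ha
  · exfalso
    obtain ⟨r, hr⟩ := h0
    obtain ⟨r', hr'⟩ := hfg
    -- The bound `K` puts `w.act m₂` below both `p` and `a` on all positive roots, while `m₁` will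
    -- lie above both `q` and `a₀`.
    obtain ⟨K, hK⟩ : ∃ K : Λ, K = ∑ i, (|coeval P i p| + |coeval P i a|) := ⟨_, rfl⟩
    have hKi : ∀ i, |coeval P i p| + |coeval P i a| ≤ K := fun i => by
      rw [hK]
      exact Finset.single_le_sum (f := fun i => |coeval P i p| + |coeval P i a|)
        (fun i _ => add_nonneg (abs_nonneg _) (abs_nonneg _)) (Finset.mem_univ i)
    obtain ⟨m₁, hm₁⟩ := hB.exists_coeval_ge (P := P) fun i =>
      max (coeval P i r) (max (coeval P i q) (coeval P i a₀))
    obtain ⟨m₂, hm₂⟩ := hB.exists_coeval_ge (P := P) fun i => max (coeval P i r') K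
    have e1 : f m₁ = g₀ m₁ := hr m₁ fun i hi => (le_max_left _ _).trans (hm₁ i hi)
    have e2 : f (w.act m₂) = g (w.act m₂) :=
      hr' m₂ fun i hi => (le_max_left _ _).trans (hm₂ i hi)
    have d1 : atlasDist P B 𝒜 (g₀ a₀) (f m₁) = coevalSum B m₁ - coevalSum B a₀ := by
      rw [e1, hX.atlasDist_eq hB hg₀, modelDist_eq_coevalSum]
      exact fun i hi => ((le_max_right _ _).trans (le_max_right _ _)).trans (hm₁ i hi)
    have d2 : atlasDist P B 𝒜 (f q) (f m₁) = coevalSum B m₁ - coevalSum B q := by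
      rw [hX.atlasDist_eq hB hf, modelDist_eq_coevalSum]
      exact fun i hi => ((le_max_left _ _).trans (le_max_right _ _)).trans (hm₁ i hi)
    have hlow : ∀ x : ModelSpace Λ P, (∀ i, |coeval P i x| ≤ K) → ∀ i, IsPositive P B i →
        coeval P i (w.act m₂) ≤ coeval P i x := by
      intro x hx i hi
      obtain ⟨j, hj, hij⟩ := hw.coeval_act (Λ := Λ) hB hi
      rw [hij]
      exact (neg_le_neg ((hx i).trans ((le_max_right _ _).trans (hm₂ j hj)))).trans
        (neg_abs_le _)
    have d3 : atlasDist P B 𝒜 (f (w.act m₂)) (g₀ a₀) =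
        coevalSum B a - coevalSum B (w.act m₂) := by
      rw [e2, ← hga, hX.atlasDist_eq hB hg, modelDist_eq_coevalSum]
      exact hlow a fun i => (le_add_of_nonneg_left (abs_nonneg _)).trans (hKi i)
    have d4 : atlasDist P B 𝒜 (f (w.act m₂)) (f p) =
        coevalSum B p - coevalSum B (w.act m₂) := by
      rw [hX.atlasDist_eq hB hf, modelDist_eq_coevalSum]
      exact hlow p fun i => (le_add_of_nonneg_right (abs_nonneg _)).trans (hKi i)
    have d5 : atlasDist P B 𝒜 (f p) (f q) = coevalSum B q - coevalSum B p := by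
      rw [hX.atlasDist_eq hB hf, modelDist_eq_coevalSum hpq]
    have t1 := hX.atlasDist_triangle hB (g₀ a₀) (f q) (f m₁)
    have t2 := hX.atlasDist_triangle hB (f (w.act m₂)) (f p) (g₀ a₀)
    have hz' : atlasDist P B 𝒜 (f p) (f q) =
      atlasDist P B 𝒜 (f p) (g₀ a₀) + atlasDist P B 𝒜 (g₀ a₀) (f q) := hz
    rw [d1, d2, ← sub_le_iff_le_add] at t1
    rw [d3, d4, ← sub_le_iff_le_add'] at t2
    rw [d5] at hz'
    have t3 := add_le_add t2 t1
    rw [← hz'] at t3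
    have t4 : coevalSum B a + (coevalSum B q - coevalSum B p) ≤
        coevalSum B a₀ + (coevalSum B q - coevalSum B p) := by
      refine le_trans (le_of_eq ?_) ((add_le_add_left t3 (coevalSum B a₀)).trans (le_of_eq ?_)) <;>
        abel
    exact hlt.not_ge (le_of_add_le_add_right t4)

end Segments

end

end GenAffineBuilding

theorem mainTheorem3 {F : Subfield ℝ} {ι M N Λ X : Type*} [Fintype ι]
    [AddCommGroup M] [Module F M] [AddCommGroup N] [Module F N]
    [AddCommGroup Λ] [LinearOrder Λ] [IsOrderedAddMonoid Λ] [Module F Λ] [IsOrderedModule F Λ]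
    (P : RootPairing ι F M N) [P.IsRootSystem]
    (B : Set ι) (hB : GenAffineBuilding.IsRootBasis P B)
    (T : AddSubgroup (GenAffineBuilding.ModelSpace Λ P))
    (hT : GenAffineBuilding.IsTranslationGroup P T)
    (𝒜 : Set (GenAffineBuilding.ModelSpace Λ P → X))
    (hX : GenAffineBuilding.IsAffineBuilding P B T 𝒜) (x y : X) :
    ∃ f ∈ 𝒜, GenAffineBuilding.seg P B 𝒜 x y ⊆ Set.range f := by
  have := hT.nontrivial
  obtain ⟨f, hf, ⟨p, rfl⟩, ⟨q, rfl⟩⟩ := hX.common_apartment x y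
  -- Rotating the chart makes the direction from `x` to `y` dominant.
  obtain ⟨w, hw⟩ := hB.exists_act_nonneg (q - p)
  have hfw := hX.comp_act_mem hf w⁻¹
  have h := hX.seg_subset_range hB hT hfw (p := w.act p) (q := w.act q) fun i hi => by
    have := hw i hi
    rw [map_sub, map_sub] at this
    exact sub_nonneg.1 this
  simp only [Function.comp_apply, GenAffineBuilding.Weyl.act_inv_act] at h
  exact ⟨_, hfw, h⟩
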